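/- Let $(\Omega,\Sigma,\mu)$ and $(S,\mathcal F,m)$ be finite measure spaces with $m(S)>0$. Let $L_0=L_0(\Omega)$ be the algebra of classes of measurable functions $\Omega\to\mathbb C$ and $L_0^h$ its real part, with the a.e. order; for $\lambda,\mu\in L_0^h$ write $\lambda\ll\mu$ if $\lambda(\omega)<\mu(\omega)$ for a.e. $\omega$. Let $q\in[0,\infty]$ and let $H$ be the space of classes of measurable functions $x:\Omega\times S\to\mathbb C$ such that $x(\omega,\cdot)\in L_2(S)$ for a.e. $\omega$ and $\int_S|x(\cdot,s)|^2\,dm(s)\in L_q(\Omega)$. (For $q=2$ this is the space $L_{2,2}(\Omega\times S)$ defined by the condition $\int_S|x(\cdot,s)|^2dm(s)\in L_2(\Omega)$; for $q=1$ it is $L_2(\Omega\times S)$; $L_q$ with $q=0$ means all measurable functions, so that $H=L_0(\Omega,L_2(S))$.) Put $\langle x,y\rangle(\omega)=\int_S x(\omega,s)\overline{y(\omega,s)}\,dm(s)\in L_0$ and $\|x\|=\langle x,x\rangle^{1/2}$. A linear map $C:H\to H$ is $L_0$-linear if $C(\alpha x)=\alpha Cx$ whenever $\alpha\in L_0$ and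 $x,\alpha x\in H$, and $L_0$-bounded if for every $B\subseteq H$ with $\{\|x\|:x\in B\}$ bounded above in $L_0^h$ the set $\{\|Cx\|:x\in B\}$ is bounded above in $L_0^h$. An orthogonal projector is an $L_0$-linear, $L_0$-bounded map $P:H\to H$ with $P^2=P$ and $\langle Px,y\rangle=\langle x,Py\rangle$. For operators on $H$ (with values in measurable functions on $\Omega\times S$), $A\le B$ means $\langle Ax,x\rangle\le\langle Bx,x\rangle$ in $L_0$ for all $x\in H$ (the difference is real and nonnegative a.e.). Let $k\in L_\infty(\Omega\times S^2)$ satisfy $k(\omega,t,s)=\overline{k(\omega,s,t)}$ a.e. and, for every $x\in H$, $\int_S\int_S k(\omega,t,s)x(\omega,s)\overline{x(\omega,t)}\,dm(s)\,dm(t)\ge0$ for a.e. $\omega$. Let $T:H\to H$ be the partial integral operator $$(Tx)(\omega,t)=\int_S k(\omega,t,s)\,x(\omega,s)\,dm(s),$$ and let $T_\omega$ be the integral operator on $L_2(S)$ with kernel $k(\omega,\cdot,\cdot)$. Then $\mathbf m=\inf_{\|x\|=1}\langle Tx,x\rangle$ and $\mathbf M=\sup_{\|x\|=1}\langle Tx,x\rangle$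 exist in $L_0^h$, and there is a family $\{E_\lambda\}_{\lambda\in L_0^h}$ of orthogonal projectors in $H$ which is glued from fiberwise spectral projections, that is, for all $\lambda\in L_0^h$ and $x\in H$, for a.e. $\omega$, $(E_\lambda x)(\omega,\cdot)$ is the orthogonal projection of $x(\omega,\cdot)$ in $L_2(S)$ onto the closed linear span of the eigenvectors of $T_\omega$ with eigenvalue $<\lambda(\omega)$, and which has the following properties: - $E_\lambda C=CE_\lambda$ for every $\lambda\in L_0^h$ and every $L_0$-linear $L_0$-bounded $C:H\to H$ with $CT=TC$; - $E_\lambda T\le\lambda E_\lambda$ and $\lambda(I-E_\lambda)\le T(I-E_\lambda)$ for every $\lambda\in L_0^h$; - $E_\lambda\le E_\mu$ whenever $\lambda\le\mu$ (in particular, whenever $\lambda\ll\mu$); - for every $\mu\in L_0^h$ and $x\in H$, $\langle E_\mu x,x\rangle=\sup_{\lambda\ll\mu}\langle E_\lambda x,x\rangle$, the supremum being taken in the ordered space $L_0$; - $E_\lambda=0$ if $\lambda\ll\mathbf m$, and $E_\lambda=I$ if $\mathbf M\ll\lambda$. -/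

import Mathlib

open MeasureTheory Filter
open scoped ENNReal ComplexOrder

namespace PartialIntegral

noncomputable section

set_option linter.unusedSectionVars false

variable {Ω S : Type*} [MeasurableSpace Ω] [MeasurableSpace S]

/-! ### Scalars: `L₀(Ω) = Ω →ₘ[μ] ℂ` and its real part `L₀ʰ(Ω) = Ω →ₘ[μ] ℝ` -/

/-- The inclusion `L₀ʰ(Ω) ⊆ L₀(Ω)`. -/
def toComplex {μ : Measure Ω} (l : Ω →ₘ[μ] ℝ) : Ω →ₘ[μ] ℂ :=
  AEEqFun.comp (fun r : ℝ => (r : ℂ)) Complex.continuous_ofReal l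

/-- `l ≪ l'`: strict inequality almost everywhere. -/
def StrictlyBelow {μ : Measure Ω} (l l' : Ω →ₘ[μ] ℝ) : Prop :=
  ∀ᵐ ω ∂μ, l ω < l' ω

variable (μ : Measure Ω) (m : Measure S) [IsFiniteMeasure μ] [IsFiniteMeasure m]

/-! ### The module `L₂,₂(Ω × S)` -/

/-- The module action of `L₀(Ω)` on measurable functions of two variables:
`(a • x)(ω, s) = a(ω) x(ω, s)`. -/
def scalarMul (a : Ω →ₘ[μ] ℂ) (x : Ω × S →ₘ[μ.prod m] ℂ) : Ω × S →ₘ[μ.prod m] ℂ :=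
  a.compQuasiMeasurePreserving Prod.fst Measure.quasiMeasurePreserving_fst * x

/-- Classes of measurable functions `x` on `Ω × S` such that `x(ω, ·)` is in `L₂(S)` for almost
every `ω` and the function `ω ↦ ∫ |x(ω, s)|² dm(s)` belongs to `L_q(Ω)`.
For `q = 2` this is the condition `∫ |x(·, s)|² dm(s) ∈ L₂(Ω)`; for `q = 1` it is `L₂(Ω × S)`, i.e.
`∫∫ |x|² dm dμ < ∞`; for `q = 0` it is the module `L₀(Ω, L₂(S))` of all measurable sections. -/
def L22 (q : ℝ≥0∞) : Submodule ℂ (Ω × S →ₘ[μ.prod m] ℂ) where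
  carrier := {x | (∀ᵐ ω ∂μ, MemLp (fun s => x (ω, s)) 2 m) ∧
    MemLp (fun ω => ∫ s, ‖x (ω, s)‖ ^ 2 ∂m) q μ}
  zero_mem' := by
    have h0 := Measure.ae_ae_of_ae_prod (AEEqFun.coeFn_zero (μ := μ.prod m) (β := ℂ))
    refine ⟨?_, ?_⟩
    · filter_upwards [h0] with ω hω
      exact (MemLp.zero (p := 2) (μ := m) (ε := ℂ)).ae_eq (EventuallyEq.symm hω)
    · refine (MemLp.zero (p := q) (μ := μ) (ε := ℝ)).ae_eq ?_
      filter_upwards [h0] with ω hω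
      have : (fun s => ‖(0 : Ω × S →ₘ[μ.prod m] ℂ) (ω, s)‖ ^ 2) =ᵐ[m] fun _ => (0 : ℝ) := by
        filter_upwards [hω] with s hs
        rw [hs]; simp
      simp [integral_congr_ae this]
  add_mem' := by
    rintro x y ⟨hx1, hx2⟩ ⟨hy1, hy2⟩
    have h0 := Measure.ae_ae_of_ae_prod (AEEqFun.coeFn_add x y)
    refine ⟨?_, ?_⟩
    · filter_upwards [h0, hx1, hy1] with ω hω h1 h2
      exact (h1.add h2).ae_eq (EventuallyEq.symm hω)
    · refine MemLp.mono ((hx2.const_mul 2).add (hy2.const_mul 2))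
        ((x + y).aestronglyMeasurable.norm.pow 2).integral_prod_right' ?_
      filter_upwards [h0, hx1, hy1] with ω hω h1 h2
      have i1 := (memLp_two_iff_integrable_sq_norm h1.1).1 h1
      have i2 := (memLp_two_iff_integrable_sq_norm h2.1).1 h2
      have : ∫ s, ‖(x + y) (ω, s)‖ ^ 2 ∂m
          ≤ ∫ s, (2 * ‖x (ω, s)‖ ^ 2 + 2 * ‖y (ω, s)‖ ^ 2) ∂m := by
        refine integral_mono_of_nonneg (Eventually.of_forall fun s => by positivity)
          ((i1.const_mul 2).add (i2.const_mul 2)) ?_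
        filter_upwards [hω] with s hs
        rw [hs]
        have := norm_add_le (x (ω, s)) (y (ω, s))
        simp only [Pi.add_apply]
        nlinarith [norm_nonneg (x (ω, s) + y (ω, s)), sq_nonneg (‖x (ω, s)‖ - ‖y (ω, s)‖)]
      rw [integral_add (i1.const_mul 2) (i2.const_mul 2), integral_const_mul,
        integral_const_mul] at this
      have hn : 0 ≤ ∫ s, ‖(x + y) (ω, s)‖ ^ 2 ∂m := integral_nonneg fun s => by positivity
      rw [Real.norm_of_nonneg hn]
      exact this.trans (le_abs_self _)
  smul_mem' := by
    rintro c x ⟨hx1, hx2⟩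
    have h0 := Measure.ae_ae_of_ae_prod (AEEqFun.coeFn_smul c x)
    refine ⟨?_, ?_⟩
    · filter_upwards [h0, hx1] with ω hω h1
      exact (h1.const_smul c).ae_eq (EventuallyEq.symm hω)
    · refine (hx2.const_mul (‖c‖ ^ 2)).ae_eq ?_
      filter_upwards [h0] with ω hω
      have : (fun s => ‖(c • x) (ω, s)‖ ^ 2) =ᵐ[m] fun s => ‖c‖ ^ 2 * ‖x (ω, s)‖ ^ 2 := by
        filter_upwards [hω] with s hs
        rw [hs]; simp [mul_pow]
      rw [integral_congr_ae this, integral_const_mul]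

variable {μ m}

/-- The `L₀(Ω)`-valued inner product `⟨x, y⟩(ω) = ∫ x(ω, s) conj(y(ω, s)) dm(s)`. -/
def inner₀ (x y : Ω × S →ₘ[μ.prod m] ℂ) : Ω →ₘ[μ] ℂ :=
  AEEqFun.mk (fun ω => ∫ s, x (ω, s) * star (y (ω, s)) ∂m)
    (x.aestronglyMeasurable.mul y.aestronglyMeasurable.star).integral_prod_right'

/-- The `L₀(Ω)`-valued norm `‖x‖(ω) = (∫ |x(ω, s)|² dm(s))^{1/2}`. -/
def norm₀ (x : Ω × S →ₘ[μ.prod m] ℂ) : Ω →ₘ[μ] ℝ :=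
  AEEqFun.mk (fun ω => Real.sqrt (∫ s, ‖x (ω, s)‖ ^ 2 ∂m))
    (Real.continuous_sqrt.comp_aestronglyMeasurable
      (x.aestronglyMeasurable.norm.pow 2).integral_prod_right')

/-! ### Operators on `L₂,₂(Ω × S)` -/

/-- `L₀(Ω)`-linearity of a (`ℂ`-linear) operator: `C (a x) = a C x` for all `a ∈ L₀(Ω)` and all `x`
such that `a x` is again in the space. -/
def IsL0Linear {q : ℝ≥0∞} (C : L22 μ m q →ₗ[ℂ] L22 μ m q) : Prop :=
  ∀ (a : Ω →ₘ[μ] ℂ) (x y : L22 μ m q),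
    (y : Ω × S →ₘ[μ.prod m] ℂ) = scalarMul μ m a x →
      (C y : Ω × S →ₘ[μ.prod m] ℂ) = scalarMul μ m a (C x)

/-- A set of elements is bounded if the set of their norms is order bounded in `L₀(Ω)`. -/
def IsL0BoundedSet {q : ℝ≥0∞} (B : Set (L22 μ m q)) : Prop :=
  BddAbove ((fun x : L22 μ m q => norm₀ (x : Ω × S →ₘ[μ.prod m] ℂ)) '' B)

/-- An operator is `L₀`-bounded if it maps bounded sets to bounded sets. -/
def IsL0Bounded {q : ℝ≥0∞} (C : L22 μ m q →ₗ[ℂ] L22 μ m q) : Prop :=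
  ∀ B : Set (L22 μ m q), IsL0BoundedSet B → IsL0BoundedSet (C '' B)

/-- Orthogonal projectors: `L₀`-linear `L₀`-bounded operators `P` with `P² = P = P*`. -/
structure IsOrthogonalProjector {q : ℝ≥0∞} (P : L22 μ m q →ₗ[ℂ] L22 μ m q) : Prop where
  l0_linear : IsL0Linear P
  l0_bounded : IsL0Bounded P
  idempotent : ∀ x, P (P x) = P x
  symmetric : ∀ x y : L22 μ m q,
    inner₀ (P x : Ω × S →ₘ[μ.prod m] ℂ) y = inner₀ (x : Ω × S →ₘ[μ.prod m] ℂ) (P y)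

/-- `A ≤ B`: the inequality `⟨A x, x⟩ ≤ ⟨B x, x⟩` holds in `L₀(Ω)` for all `x`. (On `ℂ`, `z ≤ w`
means that `w - z` is real and nonnegative.) The values of `A` and `B` are allowed to lie
outside of the space, since `l E` with `l ∈ L₀ʰ(Ω)` need not map the space into itself. -/
def OpLE {q : ℝ≥0∞} (A B : L22 μ m q → (Ω × S →ₘ[μ.prod m] ℂ)) : Prop :=
  ∀ x : L22 μ m q, inner₀ (A x) (x : Ω × S →ₘ[μ.prod m] ℂ) ≤ inner₀ (B x) x

/-- The numerical range `{⟨T x, x⟩ : ‖x‖ = 1}` in `L₀(Ω)`. -/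
def numericalRange {q : ℝ≥0∞} (T : L22 μ m q →ₗ[ℂ] L22 μ m q) : Set (Ω →ₘ[μ] ℂ) :=
  {z | ∃ x : L22 μ m q, norm₀ (x : Ω × S →ₘ[μ.prod m] ℂ) = 1 ∧
    z = inner₀ (T x : Ω × S →ₘ[μ.prod m] ℂ) x}

/-! ### Partial integral operators -/

variable (μ m) in
/-- `k ∈ L_∞(Ω × S²)`. -/
def IsBoundedKernel (k : Ω → S → S → ℂ) : Prop :=
  MemLp (fun z : (Ω × S) × S => k z.1.1 z.1.2 z.2) ∞ ((μ.prod m).prod m)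

variable (μ m) in
/-- `k(ω, t, s) = conj k(ω, s, t)` almost everywhere. -/
def IsHermitianKernel (k : Ω → S → S → ℂ) : Prop :=
  ∀ᵐ z : (Ω × S) × S ∂((μ.prod m).prod m), k z.1.1 z.1.2 z.2 = star (k z.1.1 z.2 z.1.2)

variable (μ m) in
/-- `∫∫ k(ω, t, s) x(ω, s) conj(x(ω, t)) dm(s) dm(t) ≥ 0` for all `x` in the space. -/
def IsPosSemidefKernel (q : ℝ≥0∞) (k : Ω → S → S → ℂ) : Prop :=
  ∀ x ∈ L22 μ m q, ∀ᵐ ω ∂μ, 0 ≤ ∫ t, ∫ s, k ω t s * x (ω, s) * star (x (ω, t)) ∂m ∂m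

variable (m) in
/-- The fibre integral operator `(T_ω g)(t) = ∫ k(ω, t, s) g(s) dm(s)`. -/
def fiberOp (k : Ω → S → S → ℂ) (ω : Ω) (g : S → ℂ) : S → ℂ :=
  fun t => ∫ s, k ω t s * g s ∂m

theorem aestronglyMeasurable_kernel_mul {k : Ω → S → S → ℂ} (hk : IsBoundedKernel μ m k)
    (x : Ω × S →ₘ[μ.prod m] ℂ) :
    AEStronglyMeasurable (fun z : (Ω × S) × S => k z.1.1 z.1.2 z.2 * x (z.1.1, z.2))
      ((μ.prod m).prod m) :=
  hk.1.mul (x.aestronglyMeasurable.comp_quasiMeasurePreserving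
    (MeasureTheory.QuasiMeasurePreserving.prodMap
      (Measure.quasiMeasurePreserving_fst (μ := μ) (ν := m)) (Measure.QuasiMeasurePreserving.id m)))

theorem aestronglyMeasurable_fiberOp {k : Ω → S → S → ℂ} (hk : IsBoundedKernel μ m k)
    (x : Ω × S →ₘ[μ.prod m] ℂ) :
    AEStronglyMeasurable (fun z : Ω × S => fiberOp m k z.1 (fun s => x (z.1, s)) z.2)
      (μ.prod m) :=
  (aestronglyMeasurable_kernel_mul hk x).integral_prod_right'

theorem kernel_ae_bound {k : Ω → S → S → ℂ} (hk : IsBoundedKernel μ m k) :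
    ∃ K : ℝ, ∀ᵐ z ∂((μ.prod m).prod m), ‖k z.1.1 z.1.2 z.2‖ ≤ K := by
  refine ⟨(eLpNormEssSup (fun z : (Ω × S) × S => k z.1.1 z.1.2 z.2) ((μ.prod m).prod m)).toReal, ?_⟩
  have h2 := hk.2
  rw [eLpNorm_exponent_top] at h2
  filter_upwards [enorm_ae_le_eLpNormEssSup (fun z : (Ω × S) × S => k z.1.1 z.1.2 z.2)
    ((μ.prod m).prod m)] with z hz
  have := ENNReal.toReal_mono h2.ne hz
  rwa [toReal_enorm] at this

/-- `(T x)(ω, t) = ∫ k(ω, t, s) x(ω, s) dm(s)` as a class of measurable functions. -/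
def partialInt {k : Ω → S → S → ℂ} (hk : IsBoundedKernel μ m k)
    (x : Ω × S →ₘ[μ.prod m] ℂ) : Ω × S →ₘ[μ.prod m] ℂ :=
  AEEqFun.mk (fun z => fiberOp m k z.1 (fun s => x (z.1, s)) z.2)
    (aestronglyMeasurable_fiberOp hk x)

theorem kernel_bound {k : Ω → S → S → ℂ} (hk : IsBoundedKernel μ m k) :
    ∃ K : ℝ, 0 ≤ K ∧ ∀ᵐ ω ∂μ, ∀ᵐ t ∂m,
      AEStronglyMeasurable (fun s => k ω t s) m ∧ ∀ᵐ s ∂m, ‖k ω t s‖ ≤ K := by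
  obtain ⟨K, hK⟩ := kernel_ae_bound hk
  refine ⟨max K 0, le_max_right _ _, ?_⟩
  have h1 := Measure.ae_ae_of_ae_prod (Measure.ae_ae_of_ae_prod hK)
  have h2 := Measure.ae_ae_of_ae_prod hk.1.prodMk_left
  filter_upwards [h1, h2] with ω a b
  filter_upwards [a, b] with t c d
  exact ⟨d, c.mono fun s hs => hs.trans (le_max_left _ _)⟩

theorem sq_integral_norm_le {g : S → ℂ} (hg : MemLp g 2 m) :
    (∫ s, ‖g s‖ ∂m) ^ 2 ≤ m.real Set.univ * ∫ s, ‖g s‖ ^ 2 ∂m := by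
  have i1 : Integrable (fun s => ‖g s‖) m := (hg.integrable one_le_two).norm
  have i2 : Integrable (fun s => ‖g s‖ ^ 2) m := (memLp_two_iff_integrable_sq_norm hg.1).1 hg
  set c := m.real Set.univ with hc
  set I := ∫ s, ‖g s‖ ∂m with hI
  set J := ∫ s, ‖g s‖ ^ 2 ∂m with hJ
  have hc0 : 0 ≤ c := measureReal_nonneg
  have key : 0 ≤ ∫ s, (c ^ 2 * ‖g s‖ ^ 2 - 2 * c * I * ‖g s‖ + I ^ 2) ∂m := by
    refine integral_nonneg fun s => ?_
    have := sq_nonneg (c * ‖g s‖ - I)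
    simp only [Pi.zero_apply]
    nlinarith
  have j2 : Integrable (fun s => c ^ 2 * ‖g s‖ ^ 2) m := i2.const_mul _
  have j1 : Integrable (fun s => 2 * c * I * ‖g s‖) m := i1.const_mul _
  have j3 : Integrable (fun s => c ^ 2 * ‖g s‖ ^ 2 - 2 * c * I * ‖g s‖) m := j2.sub j1
  rw [integral_add j3 (integrable_const _), integral_sub j2 j1, integral_const_mul, integral_const_mul,
    integral_const, smul_eq_mul, ← hc, ← hI, ← hJ] at key
  rcases hc0.eq_or_lt with h | h
  · have hm : m = 0 := by
      rw [← Measure.measure_univ_eq_zero]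
      have := h.symm
      rwa [hc, measureReal_eq_zero_iff] at this
    have : I = 0 := by rw [hI, hm]; simp
    rw [← h, this]; simp
  · by_contra! hcon
    nlinarith [mul_pos h (sub_pos.2 hcon)]

theorem norm_fiberOp_le {k : Ω → S → S → ℂ} {ω : Ω} {t : S} {K : ℝ}
    (h : ∀ᵐ s ∂m, ‖k ω t s‖ ≤ K) {g : S → ℂ} (hg : MemLp g 2 m) :
    ‖fiberOp m k ω g t‖ ≤ K * ∫ s, ‖g s‖ ∂m := by
  have i1 : Integrable (fun s => ‖g s‖) m := (hg.integrable one_le_two).norm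
  rw [← integral_const_mul]
  refine norm_integral_le_of_norm_le (i1.const_mul K) ?_
  filter_upwards [h] with s hs
  rw [norm_mul]
  exact mul_le_mul_of_nonneg_right hs (norm_nonneg _)

theorem partialInt_mem {k : Ω → S → S → ℂ} (hk : IsBoundedKernel μ m k) {q : ℝ≥0∞}
    {x : Ω × S →ₘ[μ.prod m] ℂ} (hx : x ∈ L22 μ m q) : partialInt hk x ∈ L22 μ m q := by
  obtain ⟨hx1, hx2⟩ := hx
  obtain ⟨K, hK0, hK⟩ := kernel_bound hk
  have hmk := Measure.ae_ae_of_ae_prod (AEEqFun.coeFn_mk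
    (fun z : Ω × S => fiberOp m k z.1 (fun s => x (z.1, s)) z.2)
    (aestronglyMeasurable_fiberOp hk x))
  have hmeas := (partialInt hk x).aestronglyMeasurable.prodMk_left
  have hbd : ∀ᵐ ω ∂μ, ∀ᵐ t ∂m, ‖partialInt hk x (ω, t)‖ ≤ K * ∫ s, ‖x (ω, s)‖ ∂m := by
    filter_upwards [hmk, hK, hx1] with ω h1 h2 h3
    filter_upwards [h1, h2] with t h4 h5
    rw [partialInt, h4]
    exact norm_fiberOp_le h5.2 h3
  refine ⟨?_, ?_⟩
  · filter_upwards [hmeas, hbd] with ω h1 h2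
    exact MemLp.of_bound h1 _ h2
  · refine MemLp.mono (hx2.const_mul ((K * m.real Set.univ) ^ 2))
      ((partialInt hk x).aestronglyMeasurable.norm.pow 2).integral_prod_right' ?_
    filter_upwards [hbd, hx1] with ω h1 h2
    have h3 : ∫ t, ‖partialInt hk x (ω, t)‖ ^ 2 ∂m
        ≤ ∫ _t, (K * ∫ s, ‖x (ω, s)‖ ∂m) ^ 2 ∂m := by
      refine integral_mono_of_nonneg (Eventually.of_forall fun s => by positivity)
        (integrable_const _) ?_
      filter_upwards [h1] with t ht
      exact pow_le_pow_left₀ (norm_nonneg _) ht 2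
    rw [integral_const, smul_eq_mul] at h3
    have h4 := sq_integral_norm_le h2
    have hc0 : 0 ≤ m.real Set.univ := measureReal_nonneg
    have hn : 0 ≤ ∫ s, ‖partialInt hk x (ω, s)‖ ^ 2 ∂m := integral_nonneg fun s => by positivity
    rw [Real.norm_of_nonneg hn]
    refine le_trans ?_ (le_abs_self _)
    calc _ ≤ _ := h3
      _ = m.real Set.univ * K ^ 2 * (∫ s, ‖x (ω, s)‖ ∂m) ^ 2 := by ring
      _ ≤ m.real Set.univ * K ^ 2 * (m.real Set.univ * ∫ s, ‖x (ω, s)‖ ^ 2 ∂m) := by gcongr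
      _ = _ := by ring

theorem integrable_kernel_mul {k : Ω → S → S → ℂ} {ω : Ω} {t : S} {K : ℝ}
    (hm : AEStronglyMeasurable (fun s => k ω t s) m)
    (h : ∀ᵐ s ∂m, ‖k ω t s‖ ≤ K) {g : S → ℂ} (hg : MemLp g 2 m) :
    Integrable (fun s => k ω t s * g s) m :=
  (hg.integrable one_le_two).bdd_mul hm h

/-- The partial integral operator `(T x)(ω, t) = ∫ k(ω, t, s) x(ω, s) dm(s)`. -/
def partialIntegralOperator {k : Ω → S → S → ℂ} (hk : IsBoundedKernel μ m k) (q : ℝ≥0∞) :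
    L22 μ m q →ₗ[ℂ] L22 μ m q where
  toFun x := ⟨partialInt hk x, partialInt_mem hk x.2⟩
  map_add' := by
    rintro ⟨x, hx⟩ ⟨y, hy⟩
    apply Subtype.ext
    change partialInt hk (x + y) = partialInt hk x + partialInt hk y
    rw [partialInt, partialInt, partialInt, AEEqFun.mk_add_mk, AEEqFun.mk_eq_mk]
    have h0 := Measure.ae_ae_of_ae_prod (AEEqFun.coeFn_add x y)
    have hA : ∀ᵐ z ∂(μ.prod m), AEStronglyMeasurable (fun s => k z.1 z.2 s) m := hk.1.prodMk_left
    obtain ⟨K', hK'⟩ := kernel_ae_bound hk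
    have hB : ∀ᵐ z ∂(μ.prod m), ∀ᵐ s ∂m, ‖k z.1 z.2 s‖ ≤ K' := Measure.ae_ae_of_ae_prod hK'
    have q1 := Measure.quasiMeasurePreserving_fst (μ := μ) (ν := m)
    filter_upwards [hA, hB, q1.ae h0, q1.ae hx.1, q1.ae hy.1] with z hzA hzB hz h1 h2
    simp only [Pi.add_apply, fiberOp]
    rw [← integral_add (integrable_kernel_mul hzA hzB h1) (integrable_kernel_mul hzA hzB h2)]
    refine integral_congr_ae ?_
    filter_upwards [hz] with s hs
    rw [hs, Pi.add_apply, mul_add]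
  map_smul' := by
    rintro c ⟨x, hx⟩
    apply Subtype.ext
    change partialInt hk (c • x) = c • partialInt hk x
    rw [partialInt, partialInt, AEEqFun.smul_mk, AEEqFun.mk_eq_mk]
    have h0 := Measure.ae_ae_of_ae_prod (AEEqFun.coeFn_smul c x)
    have q1 := Measure.quasiMeasurePreserving_fst (μ := μ) (ν := m)
    filter_upwards [q1.ae h0] with z hz
    simp only [Pi.smul_apply, fiberOp, smul_eq_mul]
    rw [← integral_const_mul]
    refine integral_congr_ae ?_
    filter_upwards [hz] with s hs
    rw [hs, Pi.smul_apply, smul_eq_mul]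
    ring

/-! ### Fibrewise spectral projections -/

variable (m) in
/-- The closed linear span in `L₂(S)` of all eigenvectors of the fibre operator `T_ω` with
(real) eigenvalue `< c`. -/
def fiberSpectralSubspace (k : Ω → S → S → ℂ) (ω : Ω) (c : ℝ) : Submodule ℂ (Lp ℂ 2 m) :=
  (Submodule.span ℂ {g : Lp ℂ 2 m | ∃ r : ℝ, r < c ∧
    fiberOp m k ω g =ᵐ[m] fun t => (r : ℂ) * g t}).topologicalClosure

variable (m) in
/-- The spectral projection of `T_ω` for `(-∞, c)`: the orthogonal projection of `L₂(S)` onto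
`fiberSpectralSubspace m k ω c`. -/
def fiberSpectralProjection (k : Ω → S → S → ℂ) (ω : Ω) (c : ℝ) : Lp ℂ 2 m →L[ℂ] Lp ℂ 2 m :=
  haveI : CompleteSpace (fiberSpectralSubspace m k ω c) :=
    (Submodule.isClosed_topologicalClosure _).completeSpace_coe
  (fiberSpectralSubspace m k ω c).starProjection

/-- `P` is glued from the fibrewise spectral projections of `T_ω` for `(-∞, l(ω))`: for every `x`,
`(P x)(ω, ·)` is the image of `x(ω, ·) ∈ L₂(S)` for almost every `ω`. -/
def IsGluedFrom {q : ℝ≥0∞} (k : Ω → S → S → ℂ) (l : Ω →ₘ[μ] ℝ)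
    (P : L22 μ m q →ₗ[ℂ] L22 μ m q) : Prop :=
  ∀ x : L22 μ m q, ∀ᵐ ω ∂μ,
    ∃ hx : MemLp (fun s => (x : Ω × S →ₘ[μ.prod m] ℂ) (ω, s)) 2 m,
      (fun t => (P x : Ω × S →ₘ[μ.prod m] ℂ) (ω, t)) =ᵐ[m]
        fiberSpectralProjection m k ω (l ω) hx.toLp

end

end PartialIntegral

open PartialIntegral

/-! For almost every ω the kernel `k ω` is bounded and hermitian on a finite measure space, so `T_ω`
is Hilbert–Schmidt, hence compact, and self-adjoint. Its real eigenspaces are mutually orthogonal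
and span a dense subspace. Any operator acting as the scalar `f r` on each eigenvector of eigenvalue
`r` (`IsDiag`) is therefore controlled by `f`: positivity, norm bounds and strong convergence are
read off from `f` on `|r| ≤ ‖T‖`. All fibrewise inequalities, and left continuity in λ, thus become
statements about the indicator function of `(-∞, c)`.

The real difficulty is gluing: the fibrewise projections must send measurable sections to measurable
sections. Here `E_λ` is obtained as a limit of polynomials in `(T - λ)/(N + |λ| + 1)`. This operator
has bounded coefficients, so it acts on the whole module even when λ is unbounded, and iterated
smoothstep polynomials converge on `[-1, 1]` to the indicator function of `(-∞, 0)`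
(`tendsto_realSharpIter`). In almost every fibre the polynomials then converge strongly to the
spectral projection (`tendsto_sharpIter_rescale`), and a pointwise limit of dominated measurable
sections is again a measurable section (`exists_hasSections_of_tendsto`).

The same construction gives commutation. If `C` is `L₀`-linear and commutes with `T`, it commutes
with every polynomial; `L₀`-boundedness gives `‖C x‖ ≤ c ‖x‖` with `c ∈ L₀ʰ` (`exists_norm_le_mul`),
which lets `C` pass to the limit.

The bounds of the numerical range exist because `L₀ʰ` is conditionally order complete
(`exists_isGLB`). They are tied to the spectral family by normalizing `E x` or `x - E x` to a unit
vector of the module (`exists_normalized`). -/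

namespace PartialIntegral

noncomputable section

set_option linter.unusedSectionVars false

variable {Ω S : Type*} [MeasurableSpace Ω] [MeasurableSpace S]
variable {μ : Measure Ω} {m : Measure S} [IsFiniteMeasure μ] [IsFiniteMeasure m]

open scoped Topology InnerProductSpace

/-! ### Compact self-adjoint operators -/

section Hilbert

variable {H : Type*} [NormedAddCommGroup H] [InnerProductSpace ℂ H]

/-- `B` acts on every eigenvector of `T` with real eigenvalue `r` as multiplication by `f r`. -/
def IsDiag (T B : H →L[ℂ] H) (f : ℝ → ℝ) : Prop :=
  ∀ (r : ℝ) (v : H), T v = (r : ℂ) • v → B v = (f r : ℂ) • v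

namespace IsDiag

variable {T B B' : H →L[ℂ] H} {f f' : ℝ → ℝ}

theorem one : IsDiag T 1 fun _ => 1 := fun r v _ => by simp

theorem self : IsDiag T T fun r => r := fun _ _ h => h

theorem add (h : IsDiag T B f) (h' : IsDiag T B' f') : IsDiag T (B + B') fun r => f r + f' r :=
  fun r v hv => by simp [h r v hv, h' r v hv, add_smul]

theorem sub (h : IsDiag T B f) (h' : IsDiag T B' f') : IsDiag T (B - B') fun r => f r - f' r :=
  fun r v hv => by simp [h r v hv, h' r v hv, sub_smul]

theorem smul (c : ℝ) (h : IsDiag T B f) : IsDiag T ((c : ℂ) • B) fun r => c * f r :=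
  fun r v hv => by simp [h r v hv, mul_smul]

theorem mul (h : IsDiag T B f) (h' : IsDiag T B' f') : IsDiag T (B * B') fun r => f r * f' r :=
  fun r v hv => by
    change B (B' v) = _
    rw [h' r v hv, map_smul, h r v hv, smul_smul, Complex.ofReal_mul, mul_comm]

end IsDiag

variable [CompleteSpace H] {T B : H →L[ℂ] H} {f : ℝ → ℝ}

/-- The spectral theorem for compact operators indexes eigenspaces by complex numbers; symmetry
makes every eigenvalue real, and the remaining eigenspaces are zero, so nothing is lost. -/
theorem topologicalClosure_iSup_real_eigenspace (hc : IsCompactOperator T)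
    (hs : (T : H →ₗ[ℂ] H).IsSymmetric) :
    (⨆ r : ℝ, Module.End.eigenspace (T : Module.End ℂ H) (r : ℂ)).topologicalClosure = ⊤ := by
  rw [Submodule.topologicalClosure_eq_top_iff, eq_bot_iff,
    ← ContinuousLinearMap.orthogonalComplement_iSup_eigenspaces_eq_bot hc hs]
  refine Submodule.orthogonal_le (iSup_le fun z => ?_)
  by_cases hz : Module.End.HasEigenvalue (T : Module.End ℂ H) z
  · have := hs.conj_eigenvalue_eq_self hz
    rw [Complex.conj_eq_iff_real] at this
    obtain ⟨r, rfl⟩ := this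
    exact le_iSup (fun r : ℝ => Module.End.eigenspace (T : Module.End ℂ H) (r : ℂ)) r
  · rw [Module.End.hasEigenvalue_iff, not_not] at hz
    rw [hz]
    exact bot_le

theorem dense_iSup_real_eigenspace (hc : IsCompactOperator T)
    (hs : (T : H →ₗ[ℂ] H).IsSymmetric) :
    Dense ((⨆ r : ℝ, Module.End.eigenspace (T : Module.End ℂ H) (r : ℂ) : Submodule ℂ H) : Set H) :=
  Submodule.dense_iff_topologicalClosure_eq_top.2 (topologicalClosure_iSup_real_eigenspace hc hs)

theorem orthogonalFamily_real_eigenspace (hs : (T : H →ₗ[ℂ] H).IsSymmetric) :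
    OrthogonalFamily ℂ (fun r : ℝ => Module.End.eigenspace (T : Module.End ℂ H) (r : ℂ))
      fun r => (Module.End.eigenspace (T : Module.End ℂ H) (r : ℂ)).subtypeₗᵢ :=
  hs.orthogonalFamily_eigenspaces.comp Complex.ofReal_injective

theorem exists_eigenvector_sum {x : H}
    (hx : x ∈ ⨆ r : ℝ, Module.End.eigenspace (T : Module.End ℂ H) (r : ℂ)) :
    ∃ (s : Finset ℝ) (a : ∀ r : ℝ, Module.End.eigenspace (T : Module.End ℂ H) (r : ℂ)),
      x = ∑ r ∈ s, (a r : H) := by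
  obtain ⟨a, ha⟩ := (Submodule.mem_iSup_iff_exists_dfinsupp _ x).1 hx
  classical
  refine ⟨a.support, a, ?_⟩
  rw [← ha]
  exact DFinsupp.lsum_apply_apply _ _ _ |>.trans (DFinsupp.sumAddHom_apply _ _)

theorem mem_real_eigenspace {r : ℝ}
    (a : Module.End.eigenspace (T : Module.End ℂ H) (r : ℂ)) : T a = (r : ℂ) • (a : H) :=
  Module.End.mem_eigenspace_iff.1 a.2

theorem abs_le_norm_of_eigenvector {r : ℝ} {v : H} (hv : T v = (r : ℂ) • v) (h0 : v ≠ 0) :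
    |r| ≤ ‖T‖ := by
  have h := T.le_opNorm v
  rw [hv, norm_smul, Complex.norm_real, Real.norm_eq_abs] at h
  exact le_of_mul_le_mul_right h (norm_pos_iff.2 h0)

/-- On a finite sum of eigenvectors `a r`, orthogonality turns the form into `∑ f r ‖a r‖²`; density
and continuity do the rest. Only `|r| ≤ ‖T‖` matters, since no other `r` has a nonzero eigenvector.
-/
theorem IsDiag.inner_nonneg (hc : IsCompactOperator T) (hs : (T : H →ₗ[ℂ] H).IsSymmetric)
    (h : IsDiag T B f) (hf : ∀ r, |r| ≤ ‖T‖ → 0 ≤ f r) (x : H) : 0 ≤ ⟪x, B x⟫_ℂ := by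
  have := Complex.orderClosedTopology
  refine (dense_iSup_real_eigenspace hc hs).induction (P := fun x => 0 ≤ ⟪x, B x⟫_ℂ) ?_
    (isClosed_le continuous_const (continuous_id.inner B.continuous)) x
  intro x hx
  obtain ⟨s, a, rfl⟩ := exists_eigenvector_sum hx
  have e : B (∑ r ∈ s, (a r : H)) = ∑ r ∈ s,
      (Module.End.eigenspace (T : Module.End ℂ H) (r : ℂ)).subtypeₗᵢ ((f r : ℂ) • a r) := by
    rw [map_sum]
    exact Finset.sum_congr rfl fun r _ => h r _ (mem_real_eigenspace (a r))
  rw [e]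
  have := (orthogonalFamily_real_eigenspace hs).inner_sum a (fun r => (f r : ℂ) • a r) s
  rw [show (∑ r ∈ s, (a r : H)) = ∑ r ∈ s,
    (Module.End.eigenspace (T : Module.End ℂ H) (r : ℂ)).subtypeₗᵢ (a r) from rfl, this]
  refine Finset.sum_nonneg fun r _ => ?_
  rw [inner_smul_right, inner_self_eq_norm_sq_to_K]
  by_cases h0 : (a r : H) = 0
  · have : a r = 0 := Subtype.ext h0
    simp [this]
  · have := hf r (abs_le_norm_of_eigenvector (mem_real_eigenspace (a r)) h0)
    have h2 : (0 : ℂ) ≤ (f r * ‖a r‖ ^ 2 : ℝ) := Complex.zero_le_real.2 (by positivity)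
    simpa using h2

theorem IsDiag.norm_le (hc : IsCompactOperator T) (hs : (T : H →ₗ[ℂ] H).IsSymmetric)
    (h : IsDiag T B f) {M : ℝ} (hf : ∀ r, |r| ≤ ‖T‖ → |f r| ≤ M) (x : H) : ‖B x‖ ≤ M * ‖x‖ := by
  have hM : 0 ≤ M := (abs_nonneg _).trans (hf 0 (by simp))
  refine (dense_iSup_real_eigenspace hc hs).induction (P := fun x => ‖B x‖ ≤ M * ‖x‖) ?_
    (isClosed_le B.continuous.norm (continuous_const.mul continuous_norm)) x
  intro x hx
  obtain ⟨s, a, rfl⟩ := exists_eigenvector_sum hx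
  have e : B (∑ r ∈ s, (a r : H)) = ∑ r ∈ s,
      (Module.End.eigenspace (T : Module.End ℂ H) (r : ℂ)).subtypeₗᵢ ((f r : ℂ) • a r) := by
    rw [map_sum]
    exact Finset.sum_congr rfl fun r _ => h r _ (mem_real_eigenspace (a r))
  have h1 := (orthogonalFamily_real_eigenspace hs).norm_sum a s
  have h2 := (orthogonalFamily_real_eigenspace hs).norm_sum (fun r => (f r : ℂ) • a r) s
  rw [e]
  refine abs_le_of_sq_le_sq' ?_ (by positivity) |>.2
  rw [h2, mul_pow, show ‖∑ r ∈ s, (a r : H)‖ ^ 2 = ∑ r ∈ s, ‖a r‖ ^ 2 from h1, Finset.mul_sum]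
  refine Finset.sum_le_sum fun r _ => ?_
  rw [norm_smul, mul_pow, Complex.norm_real, Real.norm_eq_abs]
  by_cases h0 : (a r : H) = 0
  · have : a r = 0 := Subtype.ext h0
    simp [this]
  · have := hf r (abs_le_norm_of_eigenvector (mem_real_eigenspace (a r)) h0)
    gcongr

/-- Convergence is clear on eigenvectors. The uniform bound `M` makes the family equicontinuous, so
the set of points of convergence is closed. -/
theorem IsDiag.tendsto (hc : IsCompactOperator T) (hs : (T : H →ₗ[ℂ] H).IsSymmetric)
    {ι : Type*} {l : Filter ι} {B' : ι → H →L[ℂ] H} {f' : ι → ℝ → ℝ} {M : ℝ}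
    (h' : ∀ i, IsDiag T (B' i) (f' i)) (h : IsDiag T B f)
    (hM : ∀ i x, ‖B' i x‖ ≤ M * ‖x‖) (hf : ∀ r, |r| ≤ ‖T‖ → Tendsto (fun i => f' i r) l (𝓝 (f r)))
    (x : H) : Tendsto (fun i => B' i x) l (𝓝 (B x)) := by
  have heq : Equicontinuous fun i => (B' i : H → H) := by
    refine LipschitzWith.uniformEquicontinuous (fun i => (B' i : H → H)) M.toNNReal (fun i => ?_)
      |>.equicontinuous
    refine LipschitzWith.of_dist_le_mul fun x y => ?_
    rw [dist_eq_norm, dist_eq_norm, ← map_sub]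
    exact (hM i _).trans (by gcongr; exact Real.le_coe_toNNReal M)
  refine (dense_iSup_real_eigenspace hc hs).induction
    (P := fun x => Tendsto (fun i => B' i x) l (𝓝 (B x))) ?_
    (heq.isClosed_setOfPred_tendsto B.continuous) x
  intro x hx
  obtain ⟨s, a, rfl⟩ := exists_eigenvector_sum hx
  simp only [map_sum]
  refine tendsto_finsetSum _ fun r _ => ?_
  simp only [h r _ (mem_real_eigenspace (a r)), fun i => h' i r _ (mem_real_eigenspace (a r))]
  by_cases h0 : (a r : H) = 0
  · simp only [h0, smul_zero]
    exact tendsto_const_nhds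
  · have := hf r (abs_le_norm_of_eigenvector (mem_real_eigenspace (a r)) h0)
    exact ((Complex.continuous_ofReal.tendsto _).comp this).smul_const _

/-- The closed linear span of the eigenvectors of `T` with real eigenvalue `< c`. -/
def spectralSubspace (T : H →L[ℂ] H) (c : ℝ) : Submodule ℂ H :=
  (Submodule.span ℂ {g : H | ∃ r : ℝ, r < c ∧ T g = (r : ℂ) • g}).topologicalClosure

instance (T : H →L[ℂ] H) (c : ℝ) : CompleteSpace (spectralSubspace T c) :=
  (Submodule.isClosed_topologicalClosure _).completeSpace_coe

/-- The spectral projection of `T` for `(-∞, c)`. -/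
def spectralProjection (T : H →L[ℂ] H) (c : ℝ) : H →L[ℂ] H :=
  (spectralSubspace T c).starProjection

/-- An eigenvector with eigenvalue `≥ c` is orthogonal to all those spanning the subspace, because
eigenvectors for distinct eigenvalues of a symmetric operator are orthogonal. -/
theorem isDiag_spectralProjection (hs : (T : H →ₗ[ℂ] H).IsSymmetric) (c : ℝ) :
    IsDiag T (spectralProjection T c) fun r => if r < c then 1 else 0 := by
  intro r v hv
  beta_reduce
  split_ifs with h
  · simp only [Complex.ofReal_one, one_smul]
    exact Submodule.starProjection_eq_self_iff.2
      (Submodule.le_topologicalClosure _ (Submodule.subset_span ⟨r, h, hv⟩))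
  · simp only [Complex.ofReal_zero, zero_smul]
    refine (Submodule.starProjection_apply_eq_zero_iff _).2 ?_
    rw [spectralSubspace, Submodule.orthogonal_closure]
    refine fun w hw => ?_
    refine Submodule.span_induction (p := fun w _ => ⟪w, v⟫_ℂ = 0) ?_ (by simp)
      (fun x y _ _ hx hy => by rw [inner_add_left, hx, hy, add_zero])
      (fun a x _ hx => by rw [inner_smul_left, hx, mul_zero]) hw
    rintro w ⟨r', hr', hw⟩
    exact (orthogonalFamily_real_eigenspace hs) (show r' ≠ r by rintro rfl; exact h hr')
      ⟨w, Module.End.mem_eigenspace_iff.2 hw⟩ ⟨v, Module.End.mem_eigenspace_iff.2 hv⟩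

theorem norm_spectralProjection_le (T : H →L[ℂ] H) (c : ℝ) (x : H) :
    ‖spectralProjection T c x‖ ≤ ‖x‖ :=
  Submodule.norm_starProjection_apply_le _ x

/-- The Hilbert–Schmidt argument: `T` is the norm limit of its finite-rank truncations `F s` along
the basis, the tails being estimated by Cauchy–Schwarz and Bessel. -/
theorem isCompactOperator_of_sum_le {ι : Type*} (b : HilbertBasis ι ℂ H) {C : ℝ}
    (h : ∀ s : Finset ι, ∑ i ∈ s, ‖T (b i)‖ ^ 2 ≤ C) : IsCompactOperator T := by
  classical
  have hsum : Summable fun i => ‖T (b i)‖ ^ 2 :=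
    summable_of_sum_le (fun i => by positivity) h
  let F : Finset ι → H →L[ℂ] H := fun s => ∑ i ∈ s, (innerSL ℂ (b i)).smulRight (T (b i))
  have hF : ∀ s, IsCompactOperator (F s) := by
    intro s
    refine Finset.sum_induction _ (fun A : H →L[ℂ] H => IsCompactOperator A)
      (fun A A' hA hA' => hA.add hA') isCompactOperator_zero fun i _ => ?_
    have : IsCompactOperator (innerSL ℂ (b i)) :=
      isCompactOperator_of_locallyCompactSpace_dom (innerSL ℂ (b i))
    exact this.clm_comp (ContinuousLinearMap.toSpanSingleton ℂ (T (b i)))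
  refine isCompactOperator_of_tendsto (l := atTop) (F := F) ?_ (Eventually.of_forall hF)
  rw [Metric.tendsto_atTop]
  intro ε hε
  have h2 := (summable_iff_vanishing_norm.1 hsum) ((ε / 2) ^ 2) (by positivity)
  obtain ⟨s, hs⟩ := h2
  refine ⟨s, fun t ht => ?_⟩
  rw [dist_eq_norm]
  refine lt_of_le_of_lt (ContinuousLinearMap.opNorm_le_bound _ (by positivity : 0 ≤ ε / 2) ?_)
    (half_lt_self hε)
  intro v
  have hv : Tendsto (fun u : Finset ι => F t v - F u v) atTop (𝓝 (F t v - T v)) := by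
    refine tendsto_const_nhds.sub ?_
    have := (b.hasSum_repr v).mapL T
    simpa [F, HasSum, b.repr_apply_apply] using this
  refine le_of_tendsto hv.norm ?_
  -- Comparing `F t` with larger truncations `F u` leaves a finite sum over `u \ t`, which is
  -- disjoint from `s`; letting `u` grow replaces `F u` by `T`.
  filter_upwards [eventually_ge_atTop t] with u hu
  have e : F t v - F u v = - ∑ i ∈ u \ t, ⟪b i, v⟫_ℂ • T (b i) := by
    simp only [F, ← Finset.sum_sdiff hu]
    simp 
  rw [e, norm_neg]
  have h3 : ‖∑ i ∈ u \ t, ⟪b i, v⟫_ℂ • T (b i)‖ ≤ ∑ i ∈ u \ t, ‖⟪b i, v⟫_ℂ‖ * ‖T (b i)‖ :=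
    norm_sum_le_of_le _ fun i _ => (norm_smul _ _).le
  refine h3.trans ?_
  have h4 := Finset.sum_mul_sq_le_sq_mul_sq (u \ t) (fun i => ‖⟪b i, v⟫_ℂ‖) (fun i => ‖T (b i)‖)
  have h5 := b.orthonormal.sum_inner_products_le (s := u \ t) v
  have h6 := hs (u \ t) (Finset.disjoint_of_subset_right ht Finset.sdiff_disjoint)
  have h7 := (le_abs_self _).trans h6.le
  refine abs_le_of_sq_le_sq' ?_ (by positivity) |>.2
  calc _ ≤ _ := h4
    _ ≤ ‖v‖ ^ 2 * (ε / 2) ^ 2 := by gcongr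
    _ = _ := by ring

end Hilbert

/-! ### The fibre integral operators on `L₂(S)` -/

theorem Lp_norm_sq_eq_integral (g : Lp ℂ 2 m) : ‖g‖ ^ 2 = ∫ s, ‖g s‖ ^ 2 ∂m := by
  have h : ⟪g, g⟫_ℂ = ∫ s, ⟪g s, g s⟫_ℂ ∂m := L2.inner_def g g
  simp only [inner_self_eq_norm_sq_to_K] at h
  have h2 : ∫ s, ((‖g s‖ ^ 2 : ℝ) : ℂ) ∂m = ((∫ s, ‖g s‖ ^ 2 ∂m : ℝ) : ℂ) := integral_ofReal
  refine Complex.ofReal_injective (Eq.trans ?_ h2)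
  push_cast
  exact h

theorem toLp_norm_sq_eq_integral {g : S → ℂ} (hg : MemLp g 2 m) :
    ‖hg.toLp‖ ^ 2 = ∫ s, ‖g s‖ ^ 2 ∂m := by
  rw [Lp_norm_sq_eq_integral]
  exact integral_congr_ae (hg.coeFn_toLp.mono fun s hs => by simp only [hs])

variable (m) in
/-- A measurable hermitian kernel on `S × S` bounded by `K`. -/
structure IsFiberKernel (K : ℝ) (κ : S → S → ℂ) : Prop where
  nonneg : 0 ≤ K
  meas : AEStronglyMeasurable (fun p : S × S => κ p.1 p.2) (m.prod m)
  bound : ∀ᵐ p ∂(m.prod m), ‖κ p.1 p.2‖ ≤ K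
  herm : ∀ᵐ p ∂(m.prod m), κ p.1 p.2 = star (κ p.2 p.1)

namespace IsFiberKernel

variable {K : ℝ} {k : Ω → S → S → ℂ} {ω : Ω}

theorem section_meas (h : IsFiberKernel m K (k ω)) :
    ∀ᵐ t ∂m, AEStronglyMeasurable (k ω t) m := h.meas.prodMk_left

theorem section_bound (h : IsFiberKernel m K (k ω)) :
    ∀ᵐ t ∂m, ∀ᵐ s ∂m, ‖k ω t s‖ ≤ K := Measure.ae_ae_of_ae_prod h.bound

theorem fiberOp_meas (h : IsFiberKernel m K (k ω)) {g : S → ℂ} (hg : AEStronglyMeasurable g m) :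
    AEStronglyMeasurable (fiberOp m k ω g) m :=
  (h.meas.mul hg.comp_snd).integral_prod_right'

theorem fiberOp_bound (h : IsFiberKernel m K (k ω)) {g : S → ℂ} (hg : MemLp g 2 m) :
    ∀ᵐ t ∂m, ‖fiberOp m k ω g t‖ ≤ K * ∫ s, ‖g s‖ ∂m :=
  h.section_bound.mono fun _ ht => norm_fiberOp_le ht hg

theorem fiberOp_memLp (h : IsFiberKernel m K (k ω)) {g : S → ℂ} (hg : MemLp g 2 m) :
    MemLp (fiberOp m k ω g) 2 m :=
  MemLp.of_bound (h.fiberOp_meas hg.1) _ (h.fiberOp_bound hg)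

end IsFiberKernel

theorem fiberOp_congr (k : Ω → S → S → ℂ) (ω : Ω) {g g' : S → ℂ} (h : g =ᵐ[m] g') :
    fiberOp m k ω g = fiberOp m k ω g' := by
  funext t
  exact integral_congr_ae (h.mono fun s hs => by simp only [hs])

theorem fiberOp_add_ae {K : ℝ} {k : Ω → S → S → ℂ} {ω : Ω} (h : IsFiberKernel m K (k ω))
    {f g : S → ℂ} (hf : MemLp f 2 m) (hg : MemLp g 2 m) :
    fiberOp m k ω (f + g) =ᵐ[m] fiberOp m k ω f + fiberOp m k ω g := by
  filter_upwards [h.section_meas, h.section_bound] with t h1 h2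
  simp only [fiberOp, Pi.add_apply, mul_add]
  exact integral_add (integrable_kernel_mul h1 h2 hf) (integrable_kernel_mul h1 h2 hg)

theorem fiberOp_smul (k : Ω → S → S → ℂ) (ω : Ω) (c : ℂ) (g : S → ℂ) :
    fiberOp m k ω (c • g) = c • fiberOp m k ω g := by
  funext t
  simp only [fiberOp, Pi.smul_apply, smul_eq_mul, ← integral_const_mul]
  congr 1
  funext s
  ring

/-- The fibre integral operator as a linear map of `L₂(S)`. -/
def fiberLinearMap {K : ℝ} {k : Ω → S → S → ℂ} {ω : Ω} (h : IsFiberKernel m K (k ω)) :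
    Lp ℂ 2 m →ₗ[ℂ] Lp ℂ 2 m where
  toFun g := (h.fiberOp_memLp (Lp.memLp g)).toLp
  map_add' f g := by
    rw [← MemLp.toLp_add, MemLp.toLp_eq_toLp_iff, fiberOp_congr k ω (Lp.coeFn_add f g)]
    exact fiberOp_add_ae h (Lp.memLp f) (Lp.memLp g)
  map_smul' c g := by
    rw [RingHom.id_apply, ← MemLp.toLp_const_smul, MemLp.toLp_eq_toLp_iff,
      fiberOp_congr k ω (Lp.coeFn_smul c g), fiberOp_smul]

theorem norm_fiberLinearMap_le {K : ℝ} {k : Ω → S → S → ℂ} {ω : Ω} (h : IsFiberKernel m K (k ω))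
    (g : Lp ℂ 2 m) : ‖fiberLinearMap h g‖ ≤ K * m.real Set.univ * ‖g‖ := by
  have hK := h.nonneg
  have hc : 0 ≤ m.real Set.univ := measureReal_nonneg
  refine abs_le_of_sq_le_sq' ?_ (by positivity) |>.2
  have h1 : ‖fiberLinearMap h g‖ ^ 2 = ∫ t, ‖fiberOp m k ω g t‖ ^ 2 ∂m :=
    toLp_norm_sq_eq_integral (h.fiberOp_memLp (Lp.memLp g))
  have h3 : ∫ t, ‖fiberOp m k ω g t‖ ^ 2 ∂m ≤ ∫ _t, (K * ∫ s, ‖g s‖ ∂m) ^ 2 ∂m := by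
    refine integral_mono_of_nonneg (Eventually.of_forall fun s => by positivity)
      (integrable_const _) ?_
    filter_upwards [h.fiberOp_bound (Lp.memLp g)] with t ht
    exact pow_le_pow_left₀ (norm_nonneg _) ht 2
  rw [integral_const, smul_eq_mul] at h3
  have h4 := sq_integral_norm_le (Lp.memLp g)
  rw [← Lp_norm_sq_eq_integral] at h4
  rw [h1]
  calc _ ≤ _ := h3
    _ = m.real Set.univ * K ^ 2 * (∫ s, ‖g s‖ ∂m) ^ 2 := by ring
    _ ≤ m.real Set.univ * K ^ 2 * (m.real Set.univ * ‖g‖ ^ 2) := by gcongr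
    _ = _ := by ring

open Classical in
variable (m) in
/-- The fibre integral operator as a bounded operator of `L₂(S)`; zero unless the kernel is
measurable, hermitian and bounded by `K`. -/
def fiberCLM (k : Ω → S → S → ℂ) (K : ℝ) (ω : Ω) : Lp ℂ 2 m →L[ℂ] Lp ℂ 2 m :=
  if h : IsFiberKernel m K (k ω) then
    (fiberLinearMap h).mkContinuous (K * m.real Set.univ) (norm_fiberLinearMap_le h)
  else 0

section fiberCLM

variable {K : ℝ} {k : Ω → S → S → ℂ} {ω : Ω}

theorem fiberCLM_apply (h : IsFiberKernel m K (k ω)) (g : Lp ℂ 2 m) :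
    fiberCLM m k K ω g = (h.fiberOp_memLp (Lp.memLp g)).toLp := by
  rw [fiberCLM, dif_pos h]
  rfl

theorem coeFn_fiberCLM (h : IsFiberKernel m K (k ω)) (g : Lp ℂ 2 m) :
    fiberCLM m k K ω g =ᵐ[m] fiberOp m k ω g := by
  rw [fiberCLM_apply h]
  exact MemLp.coeFn_toLp _

theorem norm_fiberCLM_le (hK : 0 ≤ K) : ‖fiberCLM m k K ω‖ ≤ K * m.real Set.univ := by
  have hc : 0 ≤ K * m.real Set.univ := mul_nonneg hK measureReal_nonneg
  by_cases h : IsFiberKernel m K (k ω)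
  · rw [fiberCLM, dif_pos h]
    exact LinearMap.mkContinuous_norm_le _ hc _
  · rw [fiberCLM, dif_neg h, norm_zero]
    exact hc

/-- For fixed `t`, the numbers `(T_ω b_i)(t)` have the moduli of the Fourier coefficients of `conj
k(ω, t, ·)`. Bessel bounds their square sum by `K² m(S)`, and integration over `t` gives a
Hilbert–Schmidt bound. -/
theorem isCompactOperator_fiberCLM (h : IsFiberKernel m K (k ω)) :
    IsCompactOperator (fiberCLM m k K ω) := by
  obtain ⟨w, b, -⟩ := exists_hilbertBasis ℂ (Lp ℂ 2 m)
  refine isCompactOperator_of_sum_le b (C := (K ^ 2 * m.real Set.univ) * m.real Set.univ)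
    fun s => ?_
  have hi : ∀ i, Integrable (fun t => ‖fiberOp m k ω (b i) t‖ ^ 2) m := fun i =>
    (memLp_two_iff_integrable_sq_norm (h.fiberOp_meas (Lp.memLp _).1)).1
      (h.fiberOp_memLp (Lp.memLp (b i)))
  have h1 : ∀ i, ‖fiberCLM m k K ω (b i)‖ ^ 2 = ∫ t, ‖fiberOp m k ω (b i) t‖ ^ 2 ∂m := fun i => by
    rw [fiberCLM_apply h]
    exact toLp_norm_sq_eq_integral _
  simp only [h1]
  rw [← integral_finsetSum _ fun i _ => hi i]
  have h2 : ∫ t, ∑ i ∈ s, ‖fiberOp m k ω (b i) t‖ ^ 2 ∂m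
      ≤ ∫ _t, K ^ 2 * m.real Set.univ ∂m := by
    refine integral_mono_of_nonneg (Eventually.of_forall fun s => by positivity)
      (integrable_const _) ?_
    filter_upwards [h.section_meas, h.section_bound] with t ht ht'
    have hu : MemLp (fun s => star (k ω t s)) 2 m :=
      MemLp.of_bound ht.star K (ht'.mono fun s hs => by rwa [norm_star])
    have h3 : ∀ i, ‖fiberOp m k ω (b i) t‖ = ‖⟪b i, hu.toLp⟫_ℂ‖ := by
      intro i
      rw [norm_inner_symm, L2.inner_def]
      congr 1
      refine integral_congr_ae ?_
      filter_upwards [hu.coeFn_toLp] with s hs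
      rw [RCLike.inner_apply, hs, starRingEnd_apply, star_star, mul_comm]
    simp only [h3]
    refine (b.orthonormal.sum_inner_products_le _).trans ?_
    rw [toLp_norm_sq_eq_integral]
    have h4 : ∫ s, ‖star (k ω t s)‖ ^ 2 ∂m ≤ ∫ _s, K ^ 2 ∂m := by
      refine integral_mono_of_nonneg (Eventually.of_forall fun s => by positivity)
        (integrable_const _) ?_
      filter_upwards [ht'] with s hs
      rw [norm_star]
      exact pow_le_pow_left₀ (norm_nonneg _) hs 2
    rw [integral_const, smul_eq_mul] at h4
    linarith
  rw [integral_const, smul_eq_mul] at h2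
  linarith

/-- Both inner products are integrals over `S × S`, by Fubini; hermitian symmetry of the kernel
makes the integrands agree after exchanging the two variables. -/
theorem isSymmetric_fiberCLM (h : IsFiberKernel m K (k ω)) :
    (fiberCLM m k K ω : Lp ℂ 2 m →ₗ[ℂ] Lp ℂ 2 m).IsSymmetric := by
  intro f g
  have hf := (Lp.memLp f).integrable one_le_two
  have hg := (Lp.memLp g).integrable one_le_two
  have hF : Integrable (fun p : S × S => k ω p.1 p.2 * (star (f p.1) * g p.2)) (m.prod m) :=
    ((LinearIsometryEquiv.integrable_comp_iff (starₗᵢ ℂ)).2 hf |>.mul_prod hg).bdd_mul h.meas h.bound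
  have h1 : ⟪f, fiberCLM m k K ω g⟫_ℂ
      = ∫ p : S × S, k ω p.1 p.2 * (star (f p.1) * g p.2) ∂(m.prod m) := by
    rw [L2.inner_def, integral_prod _ hF]
    refine integral_congr_ae ?_
    filter_upwards [coeFn_fiberCLM h g] with t ht
    rw [ht, fiberOp, RCLike.inner_apply, ← integral_mul_const]
    congr 1
    funext s
    simp only [starRingEnd_apply]
    ring
  have h2 : ⟪fiberCLM m k K ω f, g⟫_ℂ
      = ∫ p : S × S, k ω p.2 p.1 * (star (f p.2) * g p.1) ∂(m.prod m) := by
    rw [L2.inner_def, integral_prod (fun p : S × S => k ω p.2 p.1 * (star (f p.2) * g p.1)) hF.swap]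
    refine integral_congr_ae ?_
    filter_upwards [coeFn_fiberCLM h f, Measure.ae_ae_of_ae_prod h.herm] with t ht ht'
    rw [ht, fiberOp, RCLike.inner_apply, ← integral_conj, ← integral_const_mul]
    refine integral_congr_ae ?_
    filter_upwards [ht'] with s hs
    simp only [hs, map_mul, starRingEnd_apply, star_star]
    ring
  rw [ContinuousLinearMap.coe_coe, h1, h2]
  exact integral_prod_swap (fun p : S × S => k ω p.1 p.2 * (star (f p.1) * g p.2))

theorem spectralProjection_fiberCLM (h : IsFiberKernel m K (k ω)) (c : ℝ) :
    fiberSpectralProjection m k ω c = spectralProjection (fiberCLM m k K ω) c := by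
  have : fiberSpectralSubspace m k ω c = spectralSubspace (fiberCLM m k K ω) c := by
    unfold fiberSpectralSubspace spectralSubspace
    congr 2
    ext g
    refine exists_congr fun r => and_congr_right fun _ => ?_
    rw [Lp.ext_iff]
    have h1 := coeFn_fiberCLM h g
    have h2 := Lp.coeFn_smul (r : ℂ) g
    exact ⟨fun h3 => h1.trans (h3.trans h2.symm), fun h3 => h1.symm.trans (h3.trans h2)⟩
  unfold fiberSpectralProjection spectralProjection
  congr

end fiberCLM

theorem exists_isFiberKernel {k : Ω → S → S → ℂ} (hk : IsBoundedKernel μ m k)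
    (hherm : IsHermitianKernel μ m k) : ∃ K : ℝ, 0 ≤ K ∧ ∀ᵐ ω ∂μ, IsFiberKernel m K (k ω) := by
  obtain ⟨K, hK⟩ := kernel_ae_bound hk
  -- The hypotheses live on `(Ω × S) × S`; reassociating to `Ω × (S × S)` turns them into statements
  -- about almost every fibre.
  have hp := (measurePreserving_prodAssoc μ m m).symm
  have h1 := Measure.ae_ae_of_ae_prod (hp.quasiMeasurePreserving.ae hK)
  have h2 := Measure.ae_ae_of_ae_prod (hp.quasiMeasurePreserving.ae hherm)
  have h3 := (hk.1.comp_quasiMeasurePreserving hp.quasiMeasurePreserving).prodMk_left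
  refine ⟨max K 0, le_max_right _ _, ?_⟩
  filter_upwards [h1, h2, h3] with ω a b c
  exact ⟨le_max_right _ _, c, a.mono fun p hp => hp.trans (le_max_left _ _), b⟩

/-! ### Sections -/

/-- `f ω ∈ L₂(S)` is the section `u(ω, ·)` for almost every `ω`. -/
def HasSections (u : Ω × S →ₘ[μ.prod m] ℂ) (f : Ω → Lp ℂ 2 m) : Prop :=
  ∀ᵐ ω ∂μ, (fun s => u (ω, s)) =ᵐ[m] f ω

open Classical in
/-- The section `u(ω, ·)` as an element of `L₂(S)`; zero if it is not square integrable. -/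
def sec (u : Ω × S →ₘ[μ.prod m] ℂ) (ω : Ω) : Lp ℂ 2 m :=
  if h : MemLp (fun s => u (ω, s)) 2 m then h.toLp else 0

theorem sec_eq_toLp {u : Ω × S →ₘ[μ.prod m] ℂ} {ω : Ω} (h : MemLp (fun s => u (ω, s)) 2 m) :
    sec u ω = h.toLp := dif_pos h

variable {q : ℝ≥0∞}

theorem hasSections_sec (x : L22 μ m q) : HasSections (x : Ω × S →ₘ[μ.prod m] ℂ) (sec x.1) := by
  filter_upwards [x.2.1] with ω h
  rw [sec_eq_toLp h]
  exact h.coeFn_toLp.symm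

theorem aestronglyMeasurable_section (u : Ω × S →ₘ[μ.prod m] ℂ) (ω : Ω) :
    AEStronglyMeasurable (fun s => u (ω, s)) m :=
  (u.stronglyMeasurable.comp_measurable measurable_prodMk_left).aestronglyMeasurable

namespace HasSections

variable {u v : Ω × S →ₘ[μ.prod m] ℂ} {f g : Ω → Lp ℂ 2 m}

theorem memLp (h : HasSections u f) : ∀ᵐ ω ∂μ, MemLp (fun s => u (ω, s)) 2 m :=
  h.mono fun _ hω => (Lp.memLp _).ae_eq hω.symm

theorem sec_eq (h : HasSections u f) : ∀ᵐ ω ∂μ, sec u ω = f ω := by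
  filter_upwards [h, h.memLp] with ω h1 h2
  rw [sec_eq_toLp h2, Lp.ext_iff]
  exact h2.coeFn_toLp.trans h1

theorem congr (hf : HasSections u f) (h : ∀ᵐ ω ∂μ, f ω = g ω) : HasSections u g := by
  filter_upwards [hf, h] with ω h1 h2
  rwa [← h2]

theorem ext (hu : HasSections u f) (hv : HasSections v f) : u = v := by
  refine AEEqFun.ext ?_
  -- Passing from almost every section to almost every point needs a measurable coincidence set,
  -- available because representatives are strongly measurable.
  refine (Measure.ae_prod_iff_ae_ae
    (u.stronglyMeasurable.measurableSet_eq_fun v.stronglyMeasurable)).2 ?_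
  filter_upwards [hu, hv] with ω h1 h2
  exact h1.trans h2.symm

theorem zero : HasSections (0 : Ω × S →ₘ[μ.prod m] ℂ) fun _ => 0 := by
  filter_upwards [Measure.ae_ae_of_ae_prod (AEEqFun.coeFn_zero (μ := μ.prod m) (β := ℂ))] with ω h
  exact EventuallyEq.trans h (Lp.coeFn_zero ℂ 2 m).symm

theorem add (hu : HasSections u f) (hv : HasSections v g) :
    HasSections (u + v) fun ω => f ω + g ω := by
  filter_upwards [hu, hv, Measure.ae_ae_of_ae_prod (AEEqFun.coeFn_add u v)] with ω h1 h2 h3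
  filter_upwards [h1, h2, h3, Lp.coeFn_add (f ω) (g ω)] with s h1 h2 h3 h4
  rw [h3, h4, Pi.add_apply, Pi.add_apply, h1, h2]

theorem sub (hu : HasSections u f) (hv : HasSections v g) :
    HasSections (u - v) fun ω => f ω - g ω := by
  filter_upwards [hu, hv, Measure.ae_ae_of_ae_prod (AEEqFun.coeFn_sub u v)] with ω h1 h2 h3
  filter_upwards [h1, h2, h3, Lp.coeFn_sub (f ω) (g ω)] with s h1 h2 h3 h4
  rw [h3, h4, Pi.sub_apply, Pi.sub_apply, h1, h2]

theorem smul (c : ℂ) (hu : HasSections u f) : HasSections (c • u) fun ω => c • f ω := by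
  filter_upwards [hu, Measure.ae_ae_of_ae_prod (AEEqFun.coeFn_smul c u)] with ω h1 h3
  filter_upwards [h1, h3, Lp.coeFn_smul c (f ω)] with s h1 h3 h4
  rw [h3, h4, Pi.smul_apply, Pi.smul_apply, h1]

theorem scalarMul (a : Ω →ₘ[μ] ℂ) (hu : HasSections u f) :
    HasSections (scalarMul μ m a u) fun ω => a ω • f ω := by
  have h3 := Measure.ae_ae_of_ae_prod (AEEqFun.coeFn_mul
    (a.compQuasiMeasurePreserving Prod.fst (Measure.quasiMeasurePreserving_fst (ν := m))) u)
  have h5 := Measure.ae_ae_of_ae_prod (AEEqFun.coeFn_compQuasiMeasurePreserving a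
    (Measure.quasiMeasurePreserving_fst (μ := μ) (ν := m)))
  filter_upwards [hu, h3, h5] with ω h1 h3 h5
  filter_upwards [h1, h3, h5, Lp.coeFn_smul (a ω) (f ω)] with s h1 h3 h5 h4
  rw [PartialIntegral.scalarMul, h3, h4, Pi.smul_apply, Pi.mul_apply, h1, h5, smul_eq_mul]
  rfl

theorem norm_sq (hu : HasSections u f) : ∀ᵐ ω ∂μ, ∫ s, ‖u (ω, s)‖ ^ 2 ∂m = ‖f ω‖ ^ 2 := by
  filter_upwards [hu] with ω h
  rw [Lp_norm_sq_eq_integral]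
  exact integral_congr_ae (h.mono fun s hs => by simp only [hs])

theorem norm₀ (hu : HasSections u f) : ∀ᵐ ω ∂μ, norm₀ u ω = ‖f ω‖ := by
  filter_upwards [hu.norm_sq, AEEqFun.coeFn_mk (fun ω => Real.sqrt (∫ s, ‖u (ω, s)‖ ^ 2 ∂m))
    (Real.continuous_sqrt.comp_aestronglyMeasurable
      (u.aestronglyMeasurable.norm.pow 2).integral_prod_right')] with ω h1 h2
  rw [PartialIntegral.norm₀, h2, h1, Real.sqrt_sq (norm_nonneg _)]

theorem inner₀ (hu : HasSections u f) (hv : HasSections v g) :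
    ∀ᵐ ω ∂μ, inner₀ u v ω = ⟪g ω, f ω⟫_ℂ := by
  filter_upwards [hu, hv, AEEqFun.coeFn_mk (fun ω => ∫ s, u (ω, s) * star (v (ω, s)) ∂m)
    (u.aestronglyMeasurable.mul v.aestronglyMeasurable.star).integral_prod_right']
    with ω h1 h2 h3
  rw [PartialIntegral.inner₀, h3, L2.inner_def]
  refine integral_congr_ae ?_
  filter_upwards [h1, h2] with s h1 h2
  rw [h1, h2, RCLike.inner_apply, starRingEnd_apply]

/-- No measurability of `f` itself is assumed; that of its norm is inherited from the class `u`. -/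
theorem aestronglyMeasurable_norm (hu : HasSections u f) :
    AEStronglyMeasurable (fun ω => ‖f ω‖) μ :=
  (PartialIntegral.norm₀ u).aestronglyMeasurable.congr hu.norm₀

/-- Both conditions defining the space depend only on fibre norms, so fibrewise domination by an
element of the space gives membership, for every `q`. -/
theorem mem_of_norm_le {f' : Ω → Lp ℂ 2 m} (hu : HasSections u f) {x : L22 μ m q}
    (hx : HasSections (x : Ω × S →ₘ[μ.prod m] ℂ) f') {C : ℝ}
    (h : ∀ᵐ ω ∂μ, ‖f ω‖ ≤ C * ‖f' ω‖) : u ∈ L22 μ m q := by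
  refine ⟨hu.memLp, MemLp.mono (x.2.2.const_mul (C ^ 2))
    (u.aestronglyMeasurable.norm.pow 2).integral_prod_right' ?_⟩
  filter_upwards [hu.norm_sq, hx.norm_sq, h] with ω h1 h2 h3
  rw [h1, h2, ← mul_pow, norm_pow, norm_norm]
  refine le_trans ?_ (le_abs_self _)
  exact pow_le_pow_left₀ (norm_nonneg _) h3 2

theorem mem_of_norm_le_const (hu : HasSections u f) {C : ℝ}
    (h : ∀ᵐ ω ∂μ, ‖f ω‖ ≤ C) : u ∈ L22 μ m q := by
  refine ⟨hu.memLp, MemLp.of_bound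
    (u.aestronglyMeasurable.norm.pow 2).integral_prod_right' (C ^ 2) ?_⟩
  filter_upwards [hu.norm_sq, h] with ω h1 h3
  rw [h1, norm_pow, norm_norm]
  exact pow_le_pow_left₀ (norm_nonneg _) h3 2

theorem l22_ext {x y : L22 μ m q} (hx : HasSections (x : Ω × S →ₘ[μ.prod m] ℂ) f)
    (hy : HasSections (y : Ω × S →ₘ[μ.prod m] ℂ) f) : x = y :=
  Subtype.ext (hx.ext hy)

end HasSections

theorem sec_add (x y : L22 μ m q) : ∀ᵐ ω ∂μ, sec (x + y).1 ω = sec x.1 ω + sec y.1 ω :=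
  ((hasSections_sec x).add (hasSections_sec y)).sec_eq

theorem sec_sub (x y : L22 μ m q) : ∀ᵐ ω ∂μ, sec (x - y).1 ω = sec x.1 ω - sec y.1 ω :=
  ((hasSections_sec x).sub (hasSections_sec y)).sec_eq

theorem sec_smul (c : ℂ) (x : L22 μ m q) : ∀ᵐ ω ∂μ, sec (c • x).1 ω = c • sec x.1 ω :=
  ((hasSections_sec x).smul c).sec_eq

/-- Multiplication by an essentially bounded function of `ω`. -/
def boundedMul (q : ℝ≥0∞) (a : Ω →ₘ[μ] ℂ) (ha : ∃ C : ℝ, ∀ᵐ ω ∂μ, ‖a ω‖ ≤ C) :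
    L22 μ m q →ₗ[ℂ] L22 μ m q where
  toFun x := ⟨scalarMul μ m a x.1, by
    obtain ⟨C, hC⟩ := ha
    refine ((hasSections_sec x).scalarMul a).mem_of_norm_le (hasSections_sec x) (C := C) ?_
    filter_upwards [hC] with ω hω
    rw [norm_smul]
    gcongr⟩
  map_add' x y := by
    have h := hasSections_sec x
    have h' := hasSections_sec y
    refine Subtype.ext (HasSections.ext ((h.add h').scalarMul a) ?_)
    exact ((h.scalarMul a).add (h'.scalarMul a)).congr
      (Eventually.of_forall fun ω => (smul_add _ _ _).symm)
  map_smul' c x := by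
    have h := hasSections_sec x
    refine Subtype.ext (HasSections.ext ((h.smul c).scalarMul a) ?_)
    exact ((h.scalarMul a).smul c).congr
      (Eventually.of_forall fun ω => smul_comm _ _ _)

/-- `B` acts on almost every section `x(ω, ·)` as the operator `b ω`. -/
def Decomposes (B : L22 μ m q →ₗ[ℂ] L22 μ m q) (b : Ω → Lp ℂ 2 m →L[ℂ] Lp ℂ 2 m) : Prop :=
  ∀ x : L22 μ m q, HasSections (B x : Ω × S →ₘ[μ.prod m] ℂ) fun ω => b ω (sec x.1 ω)

namespace Decomposes

variable {B B' : L22 μ m q →ₗ[ℂ] L22 μ m q} {b b' : Ω → Lp ℂ 2 m →L[ℂ] Lp ℂ 2 m}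

theorem apply (h : Decomposes B b) {x : L22 μ m q} {f : Ω → Lp ℂ 2 m}
    (hf : HasSections (x : Ω × S →ₘ[μ.prod m] ℂ) f) :
    HasSections (B x : Ω × S →ₘ[μ.prod m] ℂ) fun ω => b ω (f ω) :=
  (h x).congr (hf.sec_eq.mono fun ω hω => by rw [hω])

theorem one : Decomposes (1 : Module.End ℂ (L22 μ m q)) fun _ => 1 := fun x => hasSections_sec x

theorem add (h : Decomposes B b) (h' : Decomposes B' b') :
    Decomposes (B + B') fun ω => b ω + b' ω := fun x => (h x).add (h' x)

theorem smul (c : ℂ) (h : Decomposes B b) : Decomposes (c • B) fun ω => c • b ω :=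
  fun x => (h x).smul c

theorem comp (h : Decomposes B b) (h' : Decomposes B' b') :
    Decomposes (B ∘ₗ B') fun ω => b ω * b' ω := fun x => h.apply (h' x)

theorem boundedMul (a : Ω →ₘ[μ] ℂ) (ha : ∃ C : ℝ, ∀ᵐ ω ∂μ, ‖a ω‖ ≤ C) :
    Decomposes (boundedMul (m := m) q a ha) fun ω => a ω • 1 :=
  fun x => (hasSections_sec x).scalarMul a

theorem congr (h : Decomposes B b) (hb : ∀ᵐ ω ∂μ, b ω = b' ω) : Decomposes B b' :=
  fun x => (h x).congr (hb.mono fun ω hω => by rw [hω])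

theorem isL0Linear (h : Decomposes B b) : IsL0Linear B := by
  intro a x y hy
  have h1 : HasSections (y : Ω × S →ₘ[μ.prod m] ℂ) fun ω => a ω • sec x.1 ω := by
    rw [hy]
    exact (hasSections_sec x).scalarMul a
  exact (h.apply h1).ext (((h x).scalarMul a).congr (Eventually.of_forall fun ω => by simp))

theorem isL0Bounded (h : Decomposes B b) (hb : ∀ᵐ ω ∂μ, ‖b ω‖ ≤ 1) : IsL0Bounded B := by
  rintro A ⟨c, hc⟩
  refine ⟨c, ?_⟩
  rintro _ ⟨_, ⟨x, hx, rfl⟩, rfl⟩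
  refine le_trans ?_ (hc ⟨x, hx, rfl⟩)
  rw [← AEEqFun.coeFn_le]
  filter_upwards [(h x).norm₀, (hasSections_sec x).norm₀, hb] with ω h1 h2 h3
  simp only [h1, h2]
  exact ((b ω).le_of_opNorm_le h3 _).trans (one_mul _).le

end Decomposes

theorem decomposes_partialIntegralOperator {k : Ω → S → S → ℂ} (hk : IsBoundedKernel μ m k)
    {K : ℝ} (h : ∀ᵐ ω ∂μ, IsFiberKernel m K (k ω)) :
    Decomposes (partialIntegralOperator hk q) (fiberCLM m k K) := by
  intro x
  have hmk := Measure.ae_ae_of_ae_prod (AEEqFun.coeFn_mk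
    (fun z : Ω × S => fiberOp m k z.1 (fun s => x.1 (z.1, s)) z.2)
    (aestronglyMeasurable_fiberOp hk x.1))
  filter_upwards [h, hmk, hasSections_sec x] with ω h1 h2 h3
  refine EventuallyEq.trans h2 (EventuallyEq.trans ?_ (coeFn_fiberCLM h1 _).symm)
  rw [← fiberOp_congr k ω h3]

/-! ### Polynomial approximation of the indicator function of `(-∞, 0)` -/

/-- Iterates of the smoothstep polynomial `3 s² - 2 s³`, starting at `(1 - t) / 2`. -/
def realSmoothIter (t : ℝ) : ℕ → ℝ
  | 0 => 1 / 2 * 1 + (-1 / 2) * t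
  | n + 1 => 3 * (realSmoothIter t n * realSmoothIter t n) +
      (-2) * (realSmoothIter t n * (realSmoothIter t n * realSmoothIter t n))

/-- Polynomials in `t` which converge to the indicator function of `(-∞, 0)` on `[-1, 1]`. -/
def realSharpIter (t : ℝ) (n : ℕ) : ℝ :=
  2 * (realSmoothIter t n * realSmoothIter t n) + (-1) * realSmoothIter t n

theorem realSmoothIter_mem {t : ℝ} (ht : |t| ≤ 1) (n : ℕ) :
    0 ≤ realSmoothIter t n ∧ realSmoothIter t n ≤ 1 := by
  induction n with
  | zero =>
    have := abs_le.1 ht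
    constructor <;> simp only [realSmoothIter] <;> linarith
  | succ n ih =>
    obtain ⟨h0, h1⟩ := ih
    simp only [realSmoothIter]
    set u := realSmoothIter t n
    constructor
    · nlinarith [mul_nonneg (mul_nonneg h0 h0) (sub_nonneg.2 h1), mul_nonneg h0 h0]
    · nlinarith [mul_nonneg (sub_nonneg.2 h1) (sub_nonneg.2 h1),
        mul_nonneg h0 (mul_nonneg (sub_nonneg.2 h1) (sub_nonneg.2 h1))]

theorem abs_realSharpIter_le {t : ℝ} (ht : |t| ≤ 1) (n : ℕ) : |realSharpIter t n| ≤ 1 := by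
  obtain ⟨h0, h1⟩ := realSmoothIter_mem ht n
  rw [realSharpIter, abs_le]
  constructor <;> nlinarith

/-- Each step multiplies `u n` by `u n * (3 - 2 * u n)`. Below `1/2` this factor increases with `u
n`, so it stays at most its initial value `ρ`, and `1 - ρ = (1 - 2 u 0)(1 - u 0) > 0`; the decay is
geometric. -/
theorem tendsto_smoothstep_zero {u : ℕ → ℝ} (h0 : 0 ≤ u 0) (h1 : u 0 < 1 / 2)
    (hu : ∀ n, u (n + 1) = 3 * (u n * u n) + (-2) * (u n * (u n * u n))) :
    Tendsto u atTop (𝓝 0) := by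
  set ρ := u 0 * (3 - 2 * u 0) with hρ
  have hρ0 : 0 ≤ ρ := mul_nonneg h0 (by linarith)
  have hρ1 : ρ < 1 := by nlinarith
  have key : ∀ n, 0 ≤ u n ∧ u n ≤ u 0 ∧ u n ≤ ρ ^ n := by
    intro n
    induction n with
    | zero => exact ⟨h0, le_rfl, by simp; linarith⟩
    | succ n ih =>
      obtain ⟨a, b, c⟩ := ih
      have e : u (n + 1) = u n * (u n * (3 - 2 * u n)) := by rw [hu]; ring
      have d0 : 0 ≤ u n * (3 - 2 * u n) := mul_nonneg a (by linarith)
      have d : u n * (3 - 2 * u n) ≤ ρ := by nlinarith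
      have f : u (n + 1) ≤ u n * ρ := by rw [e]; gcongr
      refine ⟨by rw [e]; positivity, ?_, ?_⟩
      · nlinarith
      · rw [pow_succ]
        exact f.trans (by gcongr)
  exact squeeze_zero (fun n => (key n).1) (fun n => (key n).2.2)
    (tendsto_pow_atTop_nhds_zero_of_lt_one hρ0 hρ1)

/-- The smoothstep map attracts to `0` and `1` and fixes `1/2`, so its iterates tend to `1`, `1/2`
or `0` according as `t < 0`, `t = 0` or `t > 0`. The final map `2 s² - s` keeps `1` and `0` and
sends `1/2` to `0`, which yields the strict inequality at `t = 0`. -/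
theorem tendsto_realSharpIter {t : ℝ} (ht : |t| ≤ 1) :
    Tendsto (realSharpIter t) atTop (𝓝 (if t < 0 then 1 else 0)) := by
  obtain ⟨ha, hb⟩ := abs_le.1 ht
  have main : ∀ {L : ℝ}, Tendsto (realSmoothIter t) atTop (𝓝 L) →
      Tendsto (realSharpIter t) atTop (𝓝 (2 * (L * L) + (-1) * L)) := fun h =>
    ((h.mul h).const_mul 2).add (h.const_mul (-1))
  rcases lt_trichotomy t 0 with h | h | h
  -- The smoothstep map is symmetric under `s ↦ 1 - s`, so the distance to `1` obeys the same
  -- recursion.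
  · have h1 : Tendsto (fun n => 1 - realSmoothIter t n) atTop (𝓝 0) := by
      refine tendsto_smoothstep_zero ?_ ?_ fun n => ?_
      · simp only [realSmoothIter]; linarith
      · simp only [realSmoothIter]; linarith
      · simp only [realSmoothIter]; ring
    have h2 : Tendsto (realSmoothIter t) atTop (𝓝 1) := by simpa using h1.const_sub 1
    rw [if_pos h]
    convert main h2 using 2
    norm_num
  · have h2 : realSmoothIter t = fun _ => 1 / 2 := by
      funext n
      induction n with
      | zero => simp [realSmoothIter, h]
      | succ n ih => simp only [realSmoothIter, ih]; norm_num
    rw [if_neg h.not_lt]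
    have h3 : Tendsto (realSmoothIter t) atTop (𝓝 (1 / 2)) := by
      rw [h2]; exact tendsto_const_nhds
    convert main h3 using 2
    norm_num
  · have h2 : Tendsto (realSmoothIter t) atTop (𝓝 0) := by
      refine tendsto_smoothstep_zero ?_ ?_ fun n => rfl
      · simp only [realSmoothIter]; linarith
      · simp only [realSmoothIter]; linarith
    rw [if_neg h.not_gt]
    convert main h2 using 2
    norm_num

/-! ### The same polynomials in an abstract algebra, for the module and for its fibres. -/

section Algebra

variable {R : Type*} [Semiring R] [Algebra ℂ R]

/-- Smoothstep iterates in an algebra. -/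
def smoothIter (A : R) : ℕ → R
  | 0 => ((1 / 2 : ℝ) : ℂ) • 1 + ((-1 / 2 : ℝ) : ℂ) • A
  | n + 1 => ((3 : ℝ) : ℂ) • (smoothIter A n * smoothIter A n) +
      ((-2 : ℝ) : ℂ) • (smoothIter A n * (smoothIter A n * smoothIter A n))

/-- The approximations `realSharpIter` in an algebra. -/
def sharpIter (A : R) (n : ℕ) : R :=
  ((2 : ℝ) : ℂ) • (smoothIter A n * smoothIter A n) + ((-1 : ℝ) : ℂ) • smoothIter A n

theorem commute_smoothIter {C A : R} (h : Commute C A) (n : ℕ) : Commute C (smoothIter A n) := by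
  induction n with
  | zero => exact ((Commute.one_right C).smul_right _).add_right (h.smul_right _)
  | succ n ih =>
    exact ((ih.mul_right ih).smul_right _).add_right
      ((ih.mul_right (ih.mul_right ih)).smul_right _)

theorem commute_sharpIter {C A : R} (h : Commute C A) (n : ℕ) : Commute C (sharpIter A n) :=
  have ih := commute_smoothIter h n
  ((ih.mul_right ih).smul_right _).add_right (ih.smul_right _)

end Algebra

/-! ### Approximation and order properties of spectral projections in one fibre. -/

section Hilbert

variable {H : Type*} [NormedAddCommGroup H] [InnerProductSpace ℂ H]

theorem IsDiag.smoothIter {T A : H →L[ℂ] H} {f : ℝ → ℝ} (h : IsDiag T A f) (n : ℕ) :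
    IsDiag T (smoothIter A n) fun r => realSmoothIter (f r) n := by
  induction n with
  | zero => exact (IsDiag.one.smul _).add (h.smul _)
  | succ n ih => exact ((ih.mul ih).smul _).add ((ih.mul (ih.mul ih)).smul _)

theorem IsDiag.sharpIter {T A : H →L[ℂ] H} {f : ℝ → ℝ} (h : IsDiag T A f) (n : ℕ) :
    IsDiag T (sharpIter A n) fun r => realSharpIter (f r) n :=
  have ih := h.smoothIter n
  ((ih.mul ih).smul _).add (ih.smul _)

/-- `(T - c) / (N + |c| + 1)`. -/
def rescale (N : ℝ) (T : H →L[ℂ] H) (c : ℝ) : H →L[ℂ] H :=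
  (((N + |c| + 1)⁻¹ : ℝ) : ℂ) • T + (((N + |c| + 1)⁻¹ * -c : ℝ) : ℂ) • 1

theorem isDiag_rescale (N : ℝ) (T : H →L[ℂ] H) (c : ℝ) :
    IsDiag T (rescale N T c) fun r => (N + |c| + 1)⁻¹ * r + (N + |c| + 1)⁻¹ * -c * 1 :=
  (IsDiag.self.smul _).add (IsDiag.one.smul _)

/-- The denominator dominates `|r - c| ≤ N + |c|`; the extra `1` keeps it nonzero. -/
theorem abs_rescale_le {N r : ℝ} (hr : |r| ≤ N) (c : ℝ) :
    |(N + |c| + 1)⁻¹ * r + (N + |c| + 1)⁻¹ * -c * 1| ≤ 1 := by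
  have hN : 0 ≤ N := (abs_nonneg r).trans hr
  have hp : 0 < N + |c| + 1 := by positivity
  rw [mul_one, ← mul_add, abs_mul, abs_of_pos (inv_pos.2 hp), inv_mul_le_one₀ hp]
  have := abs_add_le r (-c)
  rw [abs_neg] at this
  linarith

variable [CompleteSpace H] {T : H →L[ℂ] H} {N : ℝ}

theorem norm_sharpIter_rescale_le (hc : IsCompactOperator T) (hs : (T : H →ₗ[ℂ] H).IsSymmetric)
    (hN : ‖T‖ ≤ N) (c : ℝ) (n : ℕ) (x : H) : ‖sharpIter (rescale N T c) n x‖ ≤ ‖x‖ := by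
  rw [← one_mul ‖x‖]
  exact ((isDiag_rescale N T c).sharpIter n).norm_le hc hs
    (fun r hr => abs_realSharpIter_le (abs_rescale_le (hr.trans hN) c) n) x

theorem tendsto_sharpIter_rescale (hc : IsCompactOperator T)
    (hs : (T : H →ₗ[ℂ] H).IsSymmetric) (hN : ‖T‖ ≤ N) (c : ℝ) (x : H) :
    Tendsto (fun n => sharpIter (rescale N T c) n x) atTop (𝓝 (spectralProjection T c x)) := by
  refine IsDiag.tendsto hc hs (M := 1) (fun n => (isDiag_rescale N T c).sharpIter n)
    (isDiag_spectralProjection hs c) (fun n x => ?_) (fun r hr => ?_) x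
  · rw [one_mul]
    exact norm_sharpIter_rescale_le hc hs hN c n x
  · have := tendsto_realSharpIter (abs_rescale_le (hr.trans hN) c)
    convert this using 3
    have hp : 0 < (N + |c| + 1)⁻¹ := by
      have := (abs_nonneg r).trans (hr.trans hN)
      positivity
    rw [mul_one, ← mul_add, ← sub_eq_add_neg, mul_neg_iff]
    refine ⟨fun h => Or.inl ⟨hp, by linarith⟩, fun h => ?_⟩
    rcases h with h | h
    · linarith [h.2]
    · linarith [h.1]

/-- Left continuity in `c`: the open half-lines `(-∞, c - 1/(n+1))` exhaust `(-∞, c)`, so their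
indicators converge at every eigenvalue. -/
theorem tendsto_spectralProjection (hc : IsCompactOperator T)
    (hs : (T : H →ₗ[ℂ] H).IsSymmetric) (c : ℝ) (x : H) :
    Tendsto (fun n : ℕ => spectralProjection T (c - 1 / ((n : ℝ) + 1)) x) atTop
      (𝓝 (spectralProjection T c x)) := by
  refine IsDiag.tendsto hc hs (M := 1) (fun n => isDiag_spectralProjection hs _)
    (isDiag_spectralProjection hs c) (fun n x => ?_) (fun r hr => ?_) x
  · rw [one_mul]
    exact norm_spectralProjection_le _ _ _
  · by_cases h : r < c
    · rw [if_pos h]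
      refine tendsto_const_nhds.congr' ?_
      have h1 : Tendsto (fun n : ℕ => c - 1 / ((n : ℝ) + 1)) atTop (𝓝 (c - 0)) :=
        tendsto_one_div_add_atTop_nhds_zero_nat.const_sub c
      rw [sub_zero] at h1
      filter_upwards [h1.eventually (lt_mem_nhds h)] with n hn
      rw [if_pos hn]
    · rw [if_neg h]
      refine tendsto_const_nhds.congr fun n => ?_
      have : (0 : ℝ) < 1 / ((n : ℝ) + 1) := by positivity
      rw [if_neg]
      linarith

theorem inner_spectralProjection_mono (hc : IsCompactOperator T)
    (hs : (T : H →ₗ[ℂ] H).IsSymmetric) {c c' : ℝ} (h : c ≤ c') (x : H) :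
    ⟪x, spectralProjection T c x⟫_ℂ ≤ ⟪x, spectralProjection T c' x⟫_ℂ := by
  have := ((isDiag_spectralProjection hs c').sub (isDiag_spectralProjection hs c)).inner_nonneg
    hc hs (fun r _ => ?_) x
  · rwa [sub_apply, inner_sub_right, sub_nonneg] at this
  · split_ifs <;> linarith

/-- The difference has symbol `(c - r) 1_{r < c} ≥ 0`. -/
theorem inner_spectralProjection_apply_le (hc : IsCompactOperator T)
    (hs : (T : H →ₗ[ℂ] H).IsSymmetric) (c : ℝ) (x : H) :
    ⟪x, spectralProjection T c (T x)⟫_ℂ ≤ ⟪x, (c : ℂ) • spectralProjection T c x⟫_ℂ := by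
  have hP := isDiag_spectralProjection hs c
  have := ((hP.smul c).sub (hP.mul IsDiag.self)).inner_nonneg hc hs (fun r _ => ?_) x
  · rwa [sub_apply, inner_sub_right, sub_nonneg] at this
  · split_ifs <;> linarith

/-- The difference has symbol `(r - c) 1_{r ≥ c} ≥ 0`. -/
theorem inner_le_apply_sub_spectralProjection (hc : IsCompactOperator T)
    (hs : (T : H →ₗ[ℂ] H).IsSymmetric) (c : ℝ) (x : H) :
    ⟪x, (c : ℂ) • (x - spectralProjection T c x)⟫_ℂ ≤ ⟪x, T (x - spectralProjection T c x)⟫_ℂ := by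
  have hP := IsDiag.one.sub (isDiag_spectralProjection hs c)
  have := ((IsDiag.self.mul hP).sub (hP.smul c)).inner_nonneg hc hs (fun r _ => ?_) x
  · rwa [sub_apply, inner_sub_right, sub_nonneg] at this
  · split_ifs <;> linarith

end Hilbert

/-! ### Gluing fibrewise limits -/

theorem HasSections.eLpNorm_rpow {u : Ω × S →ₘ[μ.prod m] ℂ} {f : Ω → Lp ℂ 2 m}
    (hu : HasSections u f) :
    eLpNorm u 2 (μ.prod m) ^ (2 : ℝ) = ∫⁻ ω, ‖f ω‖ₑ ^ (2 : ℝ) ∂μ := by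
  have h := eLpNorm_nnreal_pow_eq_lintegral (f := u) (μ := μ.prod m) (p := 2) two_ne_zero
  simp only [NNReal.coe_ofNat, ENNReal.coe_ofNat] at h
  rw [h, lintegral_prod _ (u.aestronglyMeasurable.enorm.pow_const _)]
  refine lintegral_congr_ae ?_
  filter_upwards [hu] with ω hω
  have h' := eLpNorm_nnreal_pow_eq_lintegral (f := f ω) (μ := m) (p := 2) two_ne_zero
  simp only [NNReal.coe_ofNat, ENNReal.coe_ofNat] at h'
  rw [Lp.enorm_def, h']
  exact lintegral_congr_ae (hω.mono fun s hs => by simp only [hs])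

theorem hasSections_sec_of_L2 (Y : Lp ℂ 2 (μ.prod m)) : HasSections Y.1 (sec Y.1) := by
  have h := ((memLp_two_iff_integrable_sq_norm (Lp.memLp Y).1).1 (Lp.memLp Y)).prod_right_ae
  filter_upwards [h] with ω hω
  have h2 := (memLp_two_iff_integrable_sq_norm (aestronglyMeasurable_section Y.1 ω)).2 hω
  rw [sec_eq_toLp h2]
  exact h2.coeFn_toLp.symm

theorem HasSections.aemeasurable_enorm_rpow {u : Ω × S →ₘ[μ.prod m] ℂ} {f : Ω → Lp ℂ 2 m}
    (hu : HasSections u f) : AEMeasurable (fun ω => ‖f ω‖ₑ ^ (2 : ℝ)) μ := by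
  have := (hu.aestronglyMeasurable_norm.enorm).pow_const (2 : ℝ)
  simpa using this

/-- Measurability of the limit field `g` is the conclusion, not a hypothesis. Since `μ` is finite,
the `u n` lie in `L₂(Ω × S)` and are Cauchy there by dominated convergence. Fatou's lemma applied to
`‖f n - sec Y‖²` identifies the sections of the `L₂` limit `Y` with `g`. -/
theorem exists_hasSections_of_tendsto_of_norm_le_one {u : ℕ → Ω × S →ₘ[μ.prod m] ℂ}
    {f : ℕ → Ω → Lp ℂ 2 m} {g : Ω → Lp ℂ 2 m} (hu : ∀ n, HasSections (u n) (f n))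
    (h1 : ∀ᵐ ω ∂μ, ∀ n, ‖f n ω‖ ≤ 1)
    (hg : ∀ᵐ ω ∂μ, Tendsto (fun n => f n ω) atTop (𝓝 (g ω))) :
    ∃ v : Ω × S →ₘ[μ.prod m] ℂ, HasSections v g := by
  have hmem : ∀ n, u n ∈ Lp ℂ 2 (μ.prod m) := by
    intro n
    rw [Lp.mem_Lp_iff_eLpNorm_lt_top]
    have : eLpNorm (u n) 2 (μ.prod m) ^ (2 : ℝ) < ∞ := by
      rw [(hu n).eLpNorm_rpow]
      refine lt_of_le_of_lt (lintegral_mono_ae (g := fun _ => 1) ?_) (by simp)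
      filter_upwards [h1] with ω hω
      refine ENNReal.rpow_le_one ?_ (by norm_num)
      rw [← ofReal_norm, ENNReal.ofReal_le_one]
      exact hω n
    exact (ENNReal.rpow_lt_top_iff_of_pos (by norm_num)).1 this
  let U : ℕ → Lp ℂ 2 (μ.prod m) := fun n => ⟨u n, hmem n⟩
  have hsq : ∀ (Y Z : Lp ℂ 2 (μ.prod m)) {a b : Ω → Lp ℂ 2 m}, HasSections Y.1 a →
      HasSections Z.1 b → edist Y Z ^ (2 : ℝ) = ∫⁻ ω, ‖a ω - b ω‖ₑ ^ (2 : ℝ) ∂μ := by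
    intro Y Z a b ha hb
    rw [edist_eq_enorm_sub, Lp.enorm_def]
    exact (ha.sub hb).eLpNorm_rpow
  have hcau : CauchySeq U := by
    have ht : Tendsto (fun p : ℕ × ℕ => ∫⁻ ω, ‖f p.1 ω - f p.2 ω‖ₑ ^ (2 : ℝ) ∂μ) atTop
        (𝓝 (∫⁻ _ω, 0 ∂μ)) := by
      refine tendsto_lintegral_filter_of_dominated_convergence' (fun _ => (2 : ℝ≥0∞) ^ (2 : ℝ))
        (Eventually.of_forall fun p => ((hu p.1).sub (hu p.2)).aemeasurable_enorm_rpow)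
        (Eventually.of_forall fun p => ?_) ?_ ?_
      · filter_upwards [h1] with ω hω
        refine ENNReal.rpow_le_rpow ?_ (by norm_num)
        rw [← ofReal_norm]
        refine ENNReal.ofReal_le_of_le_toReal ?_
        have := norm_sub_le (f p.1 ω) (f p.2 ω)
        have := hω p.1
        have := hω p.2
        rw [ENNReal.toReal_ofNat]
        linarith
      · rw [lintegral_const]
        exact ENNReal.mul_ne_top (by finiteness) (by finiteness)
      · filter_upwards [hg] with ω hω
        have h2 : Tendsto (fun p : ℕ × ℕ => f p.1 ω - f p.2 ω) atTop (𝓝 (g ω - g ω)) := by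
          rw [← prod_atTop_atTop_eq]
          exact (hω.comp tendsto_fst).sub (hω.comp tendsto_snd)
        rw [sub_self] at h2
        have h3 := (ENNReal.continuous_rpow_const (y := 2)).tendsto _ |>.comp h2.enorm
        simpa [Function.comp_def] using h3
    rw [lintegral_zero] at ht
    rw [EMetric.cauchySeq_iff]
    intro ε hε
    have h2 := ht.eventually (gt_mem_nhds (ENNReal.rpow_pos_of_nonneg hε (by norm_num : (0:ℝ) ≤ 2)))
    obtain ⟨⟨N₁, N₂⟩, hN⟩ := eventually_atTop.1 h2
    refine ⟨max N₁ N₂, fun i hi j hj => ?_⟩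
    have h3 := hN (i, j) ⟨(le_max_left _ _).trans hi, (le_max_right _ _).trans hj⟩
    rw [← hsq (U i) (U j) (hu i) (hu j)] at h3
    exact (ENNReal.rpow_lt_rpow_iff (by norm_num)).1 h3
  obtain ⟨Y, hY⟩ := cauchySeq_tendsto_of_complete hcau
  have hYs := hasSections_sec_of_L2 Y
  refine ⟨Y.1, hYs.congr ?_⟩
  have hlim : Tendsto (fun n => ∫⁻ ω, ‖f n ω - sec Y.1 ω‖ₑ ^ (2 : ℝ) ∂μ) atTop (𝓝 0) := by
    have h2 : Tendsto (fun n => edist (U n) Y) atTop (𝓝 0) := tendsto_iff_edist_tendsto_0.1 hY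
    have h3 := (ENNReal.continuous_rpow_const (y := 2)).tendsto _ |>.comp h2
    simp only [ENNReal.zero_rpow_of_pos two_pos] at h3
    exact h3.congr fun n => hsq (U n) Y (hu n) hYs
  have hfat := lintegral_liminf_le' (μ := μ) (u := atTop) (f := fun n ω => ‖f n ω - sec Y.1 ω‖ₑ ^ (2 : ℝ))
    fun n => ((hu n).sub hYs).aemeasurable_enorm_rpow
  have hpt : ∀ᵐ ω ∂μ, Tendsto (fun n => ‖f n ω - sec Y.1 ω‖ₑ ^ (2 : ℝ)) atTop
      (𝓝 (‖g ω - sec Y.1 ω‖ₑ ^ (2 : ℝ))) := by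
    filter_upwards [hg] with ω h3
    exact (ENNReal.continuous_rpow_const (y := 2)).tendsto _ |>.comp
      (h3.sub_const (sec Y.1 ω)).enorm
  rw [hlim.liminf_eq, nonpos_iff_eq_zero,
    lintegral_congr_ae (hpt.mono fun ω hω => hω.liminf_eq),
    lintegral_eq_zero_iff' (aemeasurable_of_tendsto_metrizable_ae atTop
      (fun n => ((hu n).sub hYs).aemeasurable_enorm_rpow) hpt)] at hfat
  filter_upwards [hfat] with ω h2
  simp only [Pi.zero_apply, ENNReal.rpow_eq_zero_iff_of_pos two_pos, enorm_eq_zero] at h2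
  exact (sub_eq_zero.1 h2).symm

/-- Dividing by `1 + ‖x‖` reduces to fields of norm at most `1`; the limit is multiplied back
afterwards and stays in the space because it is dominated by `x`. -/
theorem exists_hasSections_of_tendsto (x : L22 μ m q) {y : ℕ → L22 μ m q}
    {f : ℕ → Ω → Lp ℂ 2 m} {g : Ω → Lp ℂ 2 m}
    (hy : ∀ n, HasSections (y n : Ω × S →ₘ[μ.prod m] ℂ) (f n))
    (h1 : ∀ᵐ ω ∂μ, ∀ n, ‖f n ω‖ ≤ ‖sec x.1 ω‖)
    (hg : ∀ᵐ ω ∂μ, Tendsto (fun n => f n ω) atTop (𝓝 (g ω))) :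
    ∃ z : L22 μ m q, HasSections (z : Ω × S →ₘ[μ.prod m] ℂ) g := by
  have hcont : Continuous fun r : ℝ => (((1 + |r|)⁻¹ : ℝ) : ℂ) := by
    refine Complex.continuous_ofReal.comp (Continuous.inv₀ (by fun_prop) fun r => ?_)
    positivity
  have hcont' : Continuous fun r : ℝ => ((1 + |r| : ℝ) : ℂ) := by fun_prop
  have hx := (hasSections_sec x).norm₀
  obtain ⟨v, hv⟩ := exists_hasSections_of_tendsto_of_norm_le_one
    (fun n => (hy n).scalarMul (AEEqFun.comp _ hcont (norm₀ x.1)))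
    (g := fun ω => (AEEqFun.comp _ hcont (norm₀ x.1)) ω • g ω)
    (by
      filter_upwards [AEEqFun.coeFn_comp _ hcont (norm₀ x.1), hx, h1] with ω h2 h3 h4 n
      rw [h2, Function.comp_apply, h3, norm_smul, Complex.norm_real, Real.norm_eq_abs, abs_inv,
        abs_norm, abs_of_pos (by positivity), inv_mul_le_one₀ (by positivity)]
      linarith [h4 n])
    (by
      filter_upwards [hg] with ω h2
      exact h2.const_smul _)
  · have h2 : HasSections (scalarMul μ m (AEEqFun.comp _ hcont' (norm₀ x.1)) v) g := by
      refine (hv.scalarMul _).congr ?_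
      filter_upwards [AEEqFun.coeFn_comp _ hcont (norm₀ x.1),
        AEEqFun.coeFn_comp _ hcont' (norm₀ x.1)] with ω h2 h3
      rw [h2, h3, smul_smul, Function.comp_apply, Function.comp_apply, ← Complex.ofReal_mul,
        mul_inv_cancel₀ (by positivity), Complex.ofReal_one, one_smul]
    refine ⟨⟨_, h2.mem_of_norm_le (hasSections_sec x) (C := 1) ?_⟩, h2⟩
    filter_upwards [h1, hg] with ω h3 h4
    rw [one_mul]
    exact le_of_tendsto h4.norm (Eventually.of_forall h3)

/-! ### Glued spectral projections -/

theorem exists_decomposes_rescale {T : L22 μ m q →ₗ[ℂ] L22 μ m q} {t : Ω → Lp ℂ 2 m →L[ℂ] Lp ℂ 2 m}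
    (hT : Decomposes T t) {N : ℝ} (hN : 0 ≤ N) (l : Ω →ₘ[μ] ℝ) :
    ∃ A : Module.End ℂ (L22 μ m q), Decomposes A (fun ω => rescale N (t ω) (l ω)) ∧
      ∀ C : Module.End ℂ (L22 μ m q), IsL0Linear C → C ∘ₗ T = T ∘ₗ C → Commute C A := by
  have hp : ∀ r : ℝ, 0 < N + |r| + 1 := fun r => by positivity
  have hinv : Continuous fun r : ℝ => (N + |r| + 1)⁻¹ :=
    Continuous.inv₀ (by fun_prop) fun r => (hp r).ne'
  have ha : Continuous fun r : ℝ => (((N + |r| + 1)⁻¹ : ℝ) : ℂ) :=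
    Complex.continuous_ofReal.comp hinv
  have hb : Continuous fun r : ℝ => (((N + |r| + 1)⁻¹ * -r : ℝ) : ℂ) :=
    Complex.continuous_ofReal.comp (hinv.mul continuous_neg)
  -- Both coefficients are bounded by `1` although `l` may be unbounded, so multiplication by them
  -- preserves the space for every `q`.
  let a := AEEqFun.comp _ ha l
  let b := AEEqFun.comp _ hb l
  have ha1 : ∃ C : ℝ, ∀ᵐ ω ∂μ, ‖a ω‖ ≤ C := by
    refine ⟨1, (AEEqFun.coeFn_comp _ ha l).mono fun ω hω => ?_⟩
    rw [hω, Function.comp_apply, Complex.norm_real, Real.norm_eq_abs, abs_inv, abs_of_pos (hp _)]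
    exact inv_le_one_of_one_le₀ (by linarith [abs_nonneg (l ω)])
  have hb1 : ∃ C : ℝ, ∀ᵐ ω ∂μ, ‖b ω‖ ≤ C := by
    refine ⟨1, (AEEqFun.coeFn_comp _ hb l).mono fun ω hω => ?_⟩
    rw [hω, Function.comp_apply, Complex.norm_real, Real.norm_eq_abs, abs_mul, abs_inv,
      abs_of_pos (hp _), abs_neg, inv_mul_le_one₀ (hp _)]
    linarith
  refine ⟨boundedMul q a ha1 ∘ₗ T + boundedMul q b hb1,
    ((Decomposes.boundedMul a ha1).comp hT |>.add (Decomposes.boundedMul b hb1)).congr ?_, ?_⟩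
  · filter_upwards [AEEqFun.coeFn_comp _ ha l, AEEqFun.coeFn_comp _ hb l] with ω h1 h2
    rw [h1, h2, smul_mul_assoc, one_mul]
    rfl
  · intro C hC hCT
    have h1 : ∀ (c : Ω →ₘ[μ] ℂ) (hc : ∃ D : ℝ, ∀ᵐ ω ∂μ, ‖c ω‖ ≤ D),
        Commute C (boundedMul q c hc : Module.End ℂ (L22 μ m q)) := fun c hc =>
      LinearMap.ext fun x => Subtype.ext (hC c x _ rfl)
    exact ((h1 a ha1).mul_right hCT).add_right (h1 b hb1)

theorem decomposes_smoothIter {A : Module.End ℂ (L22 μ m q)} {a : Ω → Lp ℂ 2 m →L[ℂ] Lp ℂ 2 m}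
    (h : Decomposes A a) (n : ℕ) : Decomposes (smoothIter A n) fun ω => smoothIter (a ω) n := by
  induction n with
  | zero => exact (Decomposes.one.smul _).add (h.smul _)
  | succ n ih => exact ((ih.comp ih).smul _).add ((ih.comp (ih.comp ih)).smul _)

theorem decomposes_sharpIter {A : Module.End ℂ (L22 μ m q)} {a : Ω → Lp ℂ 2 m →L[ℂ] Lp ℂ 2 m}
    (h : Decomposes A a) (n : ℕ) : Decomposes (sharpIter A n) fun ω => sharpIter (a ω) n :=
  have ih := decomposes_smoothIter h n
  ((ih.comp ih).smul _).add (ih.smul _)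

theorem exists_decomposes_of_forall_exists {b : Ω → Lp ℂ 2 m →L[ℂ] Lp ℂ 2 m}
    (h : ∀ x : L22 μ m q, ∃ z : L22 μ m q,
      HasSections (z : Ω × S →ₘ[μ.prod m] ℂ) fun ω => b ω (sec x.1 ω)) :
    ∃ B : L22 μ m q →ₗ[ℂ] L22 μ m q, Decomposes B b := by
  choose B hB using h
  refine ⟨{ toFun := B, map_add' := fun x y => ?_, map_smul' := fun c x => ?_ }, hB⟩
  · refine ((hB (x + y)).congr ?_).l22_ext ((hB x).add (hB y))
    filter_upwards [sec_add x y] with ω h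
    rw [h, map_add]
  · refine ((hB (c • x)).congr ?_).l22_ext ((hB x).smul c)
    filter_upwards [sec_smul c x] with ω h
    rw [h, map_smul]

/-- The bound `c` is one for the image of the unit ball. Writing `x = ‖x‖ u` with `u = x / ‖x‖`,
`L₀`-linearity applies even if `‖x‖` is unbounded, since `x` itself lies in the space. -/
theorem exists_norm_le_mul {C : L22 μ m q →ₗ[ℂ] L22 μ m q} (hC : IsL0Linear C)
    (hb : IsL0Bounded C) : ∃ c : Ω →ₘ[μ] ℝ, ∀ x : L22 μ m q,
      ∀ᵐ ω ∂μ, ‖sec (C x).1 ω‖ ≤ ‖sec x.1 ω‖ * c ω := by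
  obtain ⟨c, hc⟩ := hb {x | norm₀ x.1 ≤ 1} ⟨1, by rintro _ ⟨x, hx, rfl⟩; exact hx⟩
  refine ⟨c, fun x => ?_⟩
  -- Inversion is measurable but not continuous at `0`; the convention `0⁻¹ = 0` makes `u` vanish
  -- where `x` does.
  have hmeas : Measurable fun r : ℝ => ((r⁻¹ : ℝ) : ℂ) :=
    Complex.measurable_ofReal.comp measurable_inv
  have hx := hasSections_sec x
  have hi := AEEqFun.coeFn_compMeasurable _ hmeas (norm₀ x.1)
  have hu := (hx.scalarMul (AEEqFun.compMeasurable _ hmeas (norm₀ x.1))).congr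
    (g := fun ω => ((‖sec x.1 ω‖⁻¹ : ℝ) : ℂ) • sec x.1 ω) (by
      filter_upwards [hi, hx.norm₀] with ω h1 h2
      rw [h1, Function.comp_apply, h2])
  have hnorm : ∀ ω, ‖((‖sec x.1 ω‖⁻¹ : ℝ) : ℂ) • sec x.1 ω‖ ≤ 1 := fun ω => by
    rw [norm_smul, Complex.norm_real, norm_inv, norm_norm]
    exact inv_mul_le_one
  let u : L22 μ m q := ⟨_, hu.mem_of_norm_le_const (C := 1) (Eventually.of_forall hnorm)⟩
  have hu' : HasSections (u : Ω × S →ₘ[μ.prod m] ℂ) _ := hu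
  have huB : norm₀ u.1 ≤ 1 := by
    rw [← AEEqFun.coeFn_le]
    filter_upwards [hu'.norm₀, AEEqFun.coeFn_one (μ := μ) (β := ℝ)] with ω h1 h2
    rw [h1, h2]
    exact hnorm ω
  have hCu : norm₀ (C u).1 ≤ c := hc ⟨_, ⟨u, huB, rfl⟩, rfl⟩
  have hcoe : (⇑(toComplex (norm₀ x.1)) : Ω → ℂ) =ᵐ[μ] fun ω => ((norm₀ x.1 ω : ℝ) : ℂ) :=
    AEEqFun.coeFn_comp _ Complex.continuous_ofReal _
  have hxu : x.1 = scalarMul μ m (toComplex (norm₀ x.1)) u := by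
    refine hx.ext ((hu'.scalarMul _).congr ?_)
    filter_upwards [hcoe, hx.norm₀] with ω h1 h2
    rw [h1, h2, smul_smul, ← Complex.ofReal_mul]
    by_cases h0 : sec x.1 ω = 0
    · rw [h0, smul_zero]
    · rw [mul_inv_cancel₀ (norm_ne_zero_iff.2 h0), Complex.ofReal_one, one_smul]
  have hCx : HasSections (C x).1
      fun ω => toComplex (norm₀ x.1) ω • sec (C u).1 ω := by
    rw [hC _ u x hxu]
    exact (hasSections_sec (C u)).scalarMul _
  filter_upwards [hCx.sec_eq, hcoe, hx.norm₀, (hasSections_sec (C u)).norm₀,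
    AEEqFun.coeFn_le.2 hCu] with ω h1 h2 h3 h4 h5
  rw [h1, norm_smul, h2, Complex.norm_real, h3, norm_norm, ← h4]
  gcongr

theorem L22_map_sub (C : L22 μ m q →ₗ[ℂ] L22 μ m q) (x y : L22 μ m q) :
    C (x - y) = C x - C y := by
  have h : C (x - y) + C y = C x := by
    rw [← map_add]
    exact congrArg C (sub_add_cancel x y)
  have h' : (C (x - y)).1 + (C y).1 = (C x).1 := congrArg Subtype.val h
  exact Subtype.ext (eq_sub_of_add_eq h')

theorem tendsto_sec_apply {C : L22 μ m q →ₗ[ℂ] L22 μ m q} (hC : IsL0Linear C)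
    (hb : IsL0Bounded C) {y : ℕ → L22 μ m q} {z : L22 μ m q}
    (h : ∀ᵐ ω ∂μ, Tendsto (fun n => sec (y n).1 ω) atTop (𝓝 (sec z.1 ω))) :
    ∀ᵐ ω ∂μ, Tendsto (fun n => sec (C (y n)).1 ω) atTop (𝓝 (sec (C z).1 ω)) := by
  obtain ⟨c, hc⟩ := exists_norm_le_mul hC hb
  have h1 := ae_all_iff.2 fun n => hc (y n - z)
  have h2 := ae_all_iff.2 fun n => sec_sub (y n) z
  have h3 := ae_all_iff.2 fun n => sec_sub (C (y n)) (C z)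
  filter_upwards [h, h1, h2, h3] with ω h h1 h2 h3
  rw [tendsto_iff_norm_sub_tendsto_zero] at h ⊢
  have h4 := h.mul_const (c ω)
  rw [zero_mul] at h4
  refine squeeze_zero (fun n => norm_nonneg _) (fun n => ?_) h4
  rw [← h2, ← h3, ← L22_map_sub]
  exact h1 n

theorem exists_glued_spectralProjection {T : L22 μ m q →ₗ[ℂ] L22 μ m q}
    {t : Ω → Lp ℂ 2 m →L[ℂ] Lp ℂ 2 m} (hT : Decomposes T t) {N : ℝ}
    (ht : ∀ᵐ ω ∂μ, IsCompactOperator (t ω) ∧ (t ω : Lp ℂ 2 m →ₗ[ℂ] Lp ℂ 2 m).IsSymmetric ∧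
      ‖t ω‖ ≤ N) (hN : 0 ≤ N) (l : Ω →ₘ[μ] ℝ) :
    ∃ E : L22 μ m q →ₗ[ℂ] L22 μ m q, Decomposes E (fun ω => spectralProjection (t ω) (l ω)) ∧
      ∀ C : L22 μ m q →ₗ[ℂ] L22 μ m q, IsL0Linear C → IsL0Bounded C → C ∘ₗ T = T ∘ₗ C →
        E ∘ₗ C = C ∘ₗ E := by
  obtain ⟨A, hA, hAC⟩ := exists_decomposes_rescale hT hN l
  have hlim : ∀ x : L22 μ m q, ∀ᵐ ω ∂μ,
      Tendsto (fun n => sec (sharpIter A n x).1 ω) atTop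
        (𝓝 (spectralProjection (t ω) (l ω) (sec x.1 ω))) := by
    intro x
    have h1 := ae_all_iff.2 fun n => (decomposes_sharpIter hA n x).sec_eq
    filter_upwards [ht, h1] with ω h2 h1
    simp only [h1]
    exact tendsto_sharpIter_rescale h2.1 h2.2.1 h2.2.2 _ _
  obtain ⟨E, hE⟩ := exists_decomposes_of_forall_exists
    (b := fun ω => spectralProjection (t ω) (l ω)) fun x : L22 μ m q => by
      refine exists_hasSections_of_tendsto x (y := fun n => sharpIter A n x)
        (fun n => hasSections_sec _) ?_ (hlim x)
      have h1 := ae_all_iff.2 fun n => (decomposes_sharpIter hA n x).sec_eq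
      filter_upwards [ht, h1] with ω h2 h1 n
      rw [h1]
      exact norm_sharpIter_rescale_le h2.1 h2.2.1 h2.2.2 _ _ _
  refine ⟨E, hE, fun C hC hb hCT => LinearMap.ext fun x => ?_⟩
  have h1 : ∀ᵐ ω ∂μ, Tendsto (fun n => sec (C (sharpIter A n x)).1 ω) atTop
      (𝓝 (sec (C (E x)).1 ω)) := by
    refine tendsto_sec_apply hC hb ?_
    filter_upwards [hlim x, (hE x).sec_eq] with ω h1 h2
    rwa [h2]
  have h2 : ∀ n, C (sharpIter A n x) = sharpIter A n (C x) := fun n =>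
    LinearMap.congr_fun (commute_sharpIter (hAC C hC hCT) n).eq x
  simp only [h2] at h1
  refine (hE (C x)).l22_ext ((hasSections_sec (C (E x))).congr ?_)
  filter_upwards [h1, hlim (C x)] with ω h1 h3
  exact tendsto_nhds_unique h1 h3

/-! ### Order completeness of `L₀ʰ(Ω)` -/

/-- The functional `J f = ∫ arctan f` is finite and strictly increasing on `L₀ʰ`. A minimizing
sequence, made decreasing by running infima, has a limit `g` attaining the infimum of `J`. For `w ∈
R` the value `J (g ⊓ w)` cannot be smaller, so strict monotonicity forces `g ⊓ w = g`. -/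
theorem exists_isGLB_of_infClosed {R : Set (Ω →ₘ[μ] ℝ)} (hne : R.Nonempty) (hb : BddBelow R)
    (hR : InfClosed R) : ∃ g, IsGLB R g := by
  obtain ⟨b, hb⟩ := hb
  let J : (Ω →ₘ[μ] ℝ) → ℝ := fun f => ∫ ω, Real.arctan (f ω) ∂μ
  have hmeas : ∀ f : Ω → ℝ, AEStronglyMeasurable f μ →
      Integrable (fun ω => Real.arctan (f ω)) μ := by
    intro f hf
    refine Integrable.of_bound (Real.continuous_arctan.comp_aestronglyMeasurable hf) (Real.pi / 2)
      (Eventually.of_forall fun ω => ?_)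
    rw [Real.norm_eq_abs, abs_le]
    exact ⟨(Real.neg_pi_div_two_lt_arctan _).le, (Real.arctan_lt_pi_div_two _).le⟩
  have hJb : BddBelow (J '' R) := by
    refine ⟨∫ ω, Real.arctan (b ω) ∂μ, ?_⟩
    rintro _ ⟨f, hf, rfl⟩
    refine integral_mono_ae (hmeas _ b.aestronglyMeasurable) (hmeas _ f.aestronglyMeasurable) ?_
    filter_upwards [AEEqFun.coeFn_le.2 (hb hf)] with ω hω
    exact Real.arctan_strictMono.monotone hω
  obtain ⟨u, -, hu, huR⟩ := exists_seq_tendsto_sInf (hne.image J) hJb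
  choose f hfR hfu using huR
  let G : ℕ → Ω →ₘ[μ] ℝ := fun n => Nat.rec (f 0) (fun n g => g ⊓ f (n + 1)) n
  have hGs : ∀ n, G (n + 1) = G n ⊓ f (n + 1) := fun n => rfl
  have hGR : ∀ n, G n ∈ R := by
    intro n
    induction n with
    | zero => exact hfR 0
    | succ n ih => rw [hGs]; exact hR ih (hfR _)
  have hGf : ∀ n, G n ≤ f n := by
    intro n
    cases n with
    | zero => exact le_rfl
    | succ n => rw [hGs]; exact inf_le_right
  have hanti : Antitone G := antitone_nat_of_succ_le fun n => by rw [hGs]; exact inf_le_left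
  have h1 : ∀ᵐ ω ∂μ, Antitone fun n => G n ω := by
    have := ae_all_iff.2 fun n => AEEqFun.coeFn_le.2 (hanti (Nat.le_succ n))
    exact this.mono fun ω hω => antitone_nat_of_succ_le hω
  have h2 : ∀ᵐ ω ∂μ, BddBelow (Set.range fun n => G n ω) := by
    have := ae_all_iff.2 fun n => AEEqFun.coeFn_le.2 (hb (hGR n))
    exact this.mono fun ω hω => ⟨b ω, by rintro _ ⟨n, rfl⟩; exact hω n⟩
  have hgm : AEStronglyMeasurable (fun ω => ⨅ n, G n ω) μ :=
    (AEMeasurable.iInf fun n => (G n).aemeasurable).aestronglyMeasurable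
  let g : Ω →ₘ[μ] ℝ := AEEqFun.mk _ hgm
  have hg : ∀ᵐ ω ∂μ, g ω = ⨅ n, G n ω := AEEqFun.coeFn_mk _ hgm
  have hlim : ∀ᵐ ω ∂μ, Tendsto (fun n => G n ω) atTop (𝓝 (g ω)) := by
    filter_upwards [h1, h2, hg] with ω h1 h2 hg
    rw [hg]
    exact tendsto_atTop_ciInf h1 h2
  have hDCT : ∀ (v : ℕ → Ω →ₘ[μ] ℝ) (w : Ω →ₘ[μ] ℝ),
      (∀ᵐ ω ∂μ, Tendsto (fun n => v n ω) atTop (𝓝 (w ω))) →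
      Tendsto (fun n => J (v n)) atTop (𝓝 (J w)) := by
    intro v w h
    refine tendsto_integral_of_dominated_convergence (fun _ => Real.pi / 2)
      (fun n => (hmeas _ (v n).aestronglyMeasurable).1) (integrable_const _)
      (fun n => Eventually.of_forall fun ω => ?_) ?_
    · rw [Real.norm_eq_abs, abs_le]
      exact ⟨(Real.neg_pi_div_two_lt_arctan _).le, (Real.arctan_lt_pi_div_two _).le⟩
    · exact h.mono fun ω hω => (Real.continuous_arctan.tendsto _).comp hω
  have hJmono : ∀ v w : Ω →ₘ[μ] ℝ, v ≤ w → J v ≤ J w := fun v w h =>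
    integral_mono_ae (hmeas _ v.aestronglyMeasurable) (hmeas _ w.aestronglyMeasurable)
      ((AEEqFun.coeFn_le.2 h).mono fun ω hω => Real.arctan_strictMono.monotone hω)
  refine ⟨g, fun w hw => ?_, fun z hz => ?_⟩
  -- The limit `g` need not lie in `R`, so the estimate is made on `G n ⊓ w ∈ R` and passed to the
  -- limit.
  · have hlow : sInf (J '' R) ≤ J (g ⊓ w) := by
      refine ge_of_tendsto (hDCT (fun n => G n ⊓ w) (g ⊓ w) ?_)
        (Eventually.of_forall fun n => csInf_le hJb ⟨_, hR (hGR n) hw, rfl⟩)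
      filter_upwards [hlim, AEEqFun.coeFn_inf g w, ae_all_iff.2 fun n => AEEqFun.coeFn_inf (G n) w]
        with ω h3 h4 h5
      simp only [h4, h5]
      exact h3.inf_nhds tendsto_const_nhds
    have hup : J g ≤ sInf (J '' R) :=
      le_of_tendsto_of_tendsto' (hDCT G g hlim) hu fun n => (hJmono _ _ (hGf n)).trans (hfu n).le
    have hle : J g ≤ J (g ⊓ w) := hup.trans hlow
    have hae := (integral_eq_iff_of_ae_le (hmeas _ (g ⊓ w).aestronglyMeasurable)
      (hmeas _ g.aestronglyMeasurable) ((AEEqFun.coeFn_le.2 inf_le_left).mono fun ω hω =>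
        Real.arctan_strictMono.monotone hω)).1 (le_antisymm (hJmono _ _ inf_le_left) hle)
    rw [← AEEqFun.coeFn_le]
    filter_upwards [hae, AEEqFun.coeFn_inf g w] with ω h3 h4
    have h5 := Real.arctan_injective h3
    rw [← h5, h4]
    exact inf_le_right
  · rw [← AEEqFun.coeFn_le]
    filter_upwards [hg, ae_all_iff.2 fun n => AEEqFun.coeFn_le.2 (hz (hGR n))] with ω h3 h4
    rw [h3]
    exact le_ciInf h4

theorem exists_isGLB {R : Set (Ω →ₘ[μ] ℝ)} (hne : R.Nonempty) (hb : BddBelow R) :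
    ∃ g, IsGLB R g := by
  obtain ⟨g, hg⟩ := exists_isGLB_of_infClosed (R := infClosure R)
    (hne.mono subset_infClosure) (by rw [BddBelow, lowerBounds_infClosure]; exact hb)
    infClosed_infClosure
  exact ⟨g, isGLB_infClosure.1 hg⟩

theorem exists_isLUB {R : Set (Ω →ₘ[μ] ℝ)} (hne : R.Nonempty) (hb : BddAbove R) :
    ∃ g, IsLUB R g := by
  obtain ⟨f, hf⟩ := hne
  obtain ⟨g, hg⟩ := exists_isGLB (R := upperBounds R) hb ⟨f, fun w hw => hw hf⟩
  exact ⟨g, isGLB_upperBounds.1 hg⟩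

/-! ### Transfer of bounds between `L₀ʰ` and `L₀`. -/

theorem coeFn_toComplex (l : Ω →ₘ[μ] ℝ) : ∀ᵐ ω ∂μ, toComplex l ω = (l ω : ℂ) :=
  AEEqFun.coeFn_comp _ Complex.continuous_ofReal l

theorem toComplex_le_iff {f g : Ω →ₘ[μ] ℝ} : toComplex f ≤ toComplex g ↔ f ≤ g := by
  rw [← AEEqFun.coeFn_le, ← AEEqFun.coeFn_le]
  constructor
  · intro h
    filter_upwards [h, coeFn_toComplex f, coeFn_toComplex g] with ω h1 h2 h3
    rwa [h2, h3, Complex.real_le_real] at h1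
  · intro h
    filter_upwards [h, coeFn_toComplex f, coeFn_toComplex g] with ω h1 h2 h3
    rwa [h2, h3, Complex.real_le_real]

theorem exists_toComplex_eq {w : Ω →ₘ[μ] ℂ} (h : ∀ᵐ ω ∂μ, (w ω).im = 0) :
    ∃ w', toComplex w' = w := by
  refine ⟨AEEqFun.comp _ Complex.continuous_re w, AEEqFun.ext ?_⟩
  filter_upwards [h, coeFn_toComplex (AEEqFun.comp _ Complex.continuous_re w),
    AEEqFun.coeFn_comp _ Complex.continuous_re w] with ω h1 h2 h3
  rw [h2, h3]
  exact Complex.ext rfl h1.symm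

theorem im_eq_zero_iff_of_le {w w' : Ω →ₘ[μ] ℂ} (h : w ≤ w') :
    (∀ᵐ ω ∂μ, (w ω).im = 0) ↔ ∀ᵐ ω ∂μ, (w' ω).im = 0 := by
  have := AEEqFun.coeFn_le.2 h
  exact Filter.eventually_congr (this.mono fun ω hω => by rw [(Complex.le_def.1 hω).2])

theorem im_toComplex (f : Ω →ₘ[μ] ℝ) : ∀ᵐ ω ∂μ, (toComplex f ω).im = 0 :=
  (coeFn_toComplex f).mono fun ω hω => by rw [hω, Complex.ofReal_im]

/-- Comparable complex numbers have equal imaginary parts, so every lower bound of a nonempty set of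
real elements is real, and the complex bound problem is the real one. -/
theorem isGLB_toComplex_image {R : Set (Ω →ₘ[μ] ℝ)} (hne : R.Nonempty) {g : Ω →ₘ[μ] ℝ}
    (hg : IsGLB R g) : IsGLB (toComplex '' R) (toComplex g) := by
  refine ⟨?_, fun w hw => ?_⟩
  · rintro _ ⟨f, hf, rfl⟩
    exact toComplex_le_iff.2 (hg.1 hf)
  · obtain ⟨f, hf⟩ := hne
    obtain ⟨w, rfl⟩ := exists_toComplex_eq ((im_eq_zero_iff_of_le (hw ⟨f, hf, rfl⟩)).2
      (im_toComplex f))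
    exact toComplex_le_iff.2 (hg.2 fun f hf => toComplex_le_iff.1 (hw ⟨f, hf, rfl⟩))

theorem isLUB_toComplex_image {R : Set (Ω →ₘ[μ] ℝ)} (hne : R.Nonempty) {g : Ω →ₘ[μ] ℝ}
    (hg : IsLUB R g) : IsLUB (toComplex '' R) (toComplex g) := by
  refine ⟨?_, fun w hw => ?_⟩
  · rintro _ ⟨f, hf, rfl⟩
    exact toComplex_le_iff.2 (hg.1 hf)
  · obtain ⟨f, hf⟩ := hne
    obtain ⟨w, rfl⟩ := exists_toComplex_eq ((im_eq_zero_iff_of_le (hw ⟨f, hf, rfl⟩)).1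
      (im_toComplex f))
    exact toComplex_le_iff.2 (hg.2 fun f hf => toComplex_le_iff.1 (hw ⟨f, hf, rfl⟩))

/-! ### Unit vectors and the numerical range -/

theorem exists_unit_hasSections (hS : m ≠ 0) : ∃ (u : Ω × S →ₘ[μ.prod m] ℂ) (e : Lp ℂ 2 m),
    ‖e‖ = 1 ∧ HasSections u fun _ => e := by
  have : NeZero m := ⟨hS⟩
  have hm : 0 < m.real Set.univ := by simp [measureReal_def, ENNReal.toReal_pos_iff, hS]
  set c : ℂ := (((Real.sqrt (m.real Set.univ))⁻¹ : ℝ) : ℂ) with hc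
  have hcm : MemLp (fun _ : S => c) 2 m := memLp_const c
  refine ⟨AEEqFun.const _ c, hcm.toLp, ?_, ?_⟩
  · have hcn : ‖c‖ ^ 2 = (m.real Set.univ)⁻¹ := by
      rw [hc, Complex.norm_real, norm_inv, Real.norm_eq_abs, inv_pow, sq_abs, Real.sq_sqrt hm.le]
    have h := toLp_norm_sq_eq_integral hcm
    rw [integral_const, smul_eq_mul, hcn, mul_inv_cancel₀ hm.ne'] at h
    exact (pow_eq_one_iff_of_nonneg (norm_nonneg _) two_ne_zero).1 h
  · filter_upwards [Measure.ae_ae_of_ae_prod (AEEqFun.coeFn_const (μ := μ.prod m) (Ω × S) c)]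
      with ω hω
    exact EventuallyEq.trans hω hcm.coeFn_toLp.symm

/-- Membership in the numerical range requires norm `1` in almost every fibre, so where `y` vanishes
the quotient `y / ‖y‖` is replaced by a fixed unit vector `e`. -/
theorem exists_normalized (hS : m ≠ 0) (y : L22 μ m q) : ∃ u : L22 μ m q,
    norm₀ (u : Ω × S →ₘ[μ.prod m] ℂ) = 1 ∧
    ∀ᵐ ω ∂μ, ‖sec u.1 ω‖ = 1 ∧ (sec y.1 ω ≠ 0 →
      sec u.1 ω = ((‖sec y.1 ω‖⁻¹ : ℝ) : ℂ) • sec y.1 ω) := by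
  obtain ⟨v, e, he, hv⟩ := exists_unit_hasSections (μ := μ) hS
  have hma : Measurable fun r : ℝ => ((r⁻¹ : ℝ) : ℂ) :=
    Complex.measurable_ofReal.comp measurable_inv
  have hmb : Measurable fun r : ℝ => if r = 0 then (1 : ℂ) else 0 :=
    Measurable.ite (measurableSet_singleton 0) measurable_const measurable_const
  have hy := hasSections_sec y
  have hu := ((hy.scalarMul (AEEqFun.compMeasurable _ hma (norm₀ y.1))).add
    (hv.scalarMul (AEEqFun.compMeasurable _ hmb (norm₀ y.1)))).congr
    (g := fun ω => ((‖sec y.1 ω‖⁻¹ : ℝ) : ℂ) • sec y.1 ω +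
      (if ‖sec y.1 ω‖ = 0 then (1 : ℂ) else 0) • e) (by
      filter_upwards [AEEqFun.coeFn_compMeasurable _ hma (norm₀ y.1),
        AEEqFun.coeFn_compMeasurable _ hmb (norm₀ y.1), hy.norm₀] with ω h1 h2 h3
      rw [h1, h2, Function.comp_apply, Function.comp_apply, h3])
  have hnorm : ∀ ω, ‖((‖sec y.1 ω‖⁻¹ : ℝ) : ℂ) • sec y.1 ω +
      (if ‖sec y.1 ω‖ = 0 then (1 : ℂ) else 0) • e‖ = 1 := by
    intro ω
    by_cases h0 : sec y.1 ω = 0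
    · simp [h0, he]
    · rw [if_neg (norm_ne_zero_iff.2 h0), zero_smul, add_zero, norm_smul, Complex.norm_real,
        norm_inv, norm_norm, inv_mul_cancel₀ (norm_ne_zero_iff.2 h0)]
  refine ⟨⟨_, hu.mem_of_norm_le_const (C := 1) (Eventually.of_forall fun ω => (hnorm ω).le)⟩,
    AEEqFun.ext ?_, ?_⟩
  · filter_upwards [hu.norm₀, AEEqFun.coeFn_one (μ := μ) (β := ℝ)] with ω h1 h2
    rw [h1, h2, hnorm, Pi.one_apply]
  · filter_upwards [hu.sec_eq] with ω h1
    rw [h1]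
    refine ⟨hnorm ω, fun h0 => ?_⟩
    rw [if_neg (norm_ne_zero_iff.2 h0), zero_smul, add_zero]

theorem ae_norm_sec_eq_one {u : L22 μ m q} (hu : norm₀ (u : Ω × S →ₘ[μ.prod m] ℂ) = 1) :
    ∀ᵐ ω ∂μ, ‖sec u.1 ω‖ = 1 := by
  filter_upwards [(hasSections_sec u).norm₀, AEEqFun.coeFn_one (μ := μ) (β := ℝ)] with ω h1 h2
  rw [← h1, hu, h2, Pi.one_apply]

section NumericalRange

variable {T : L22 μ m q →ₗ[ℂ] L22 μ m q} {t : Ω → Lp ℂ 2 m →L[ℂ] Lp ℂ 2 m} {N : ℝ}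

theorem exists_bounds_numericalRange (hS : m ≠ 0) (hT : Decomposes T t)
    (hs : ∀ᵐ ω ∂μ, (t ω : Lp ℂ 2 m →ₗ[ℂ] Lp ℂ 2 m).IsSymmetric)
    (hN : ∀ᵐ ω ∂μ, ‖t ω‖ ≤ N) : ∃ lo hi : Ω →ₘ[μ] ℝ,
      IsGLB (numericalRange T) (toComplex lo) ∧ IsLUB (numericalRange T) (toComplex hi) := by
  have hinner : ∀ x : L22 μ m q, ∀ᵐ ω ∂μ,
      inner₀ (T x : Ω × S →ₘ[μ.prod m] ℂ) x.1 ω = ⟪sec x.1 ω, t ω (sec x.1 ω)⟫_ℂ :=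
    fun x => (hT x).inner₀ (hasSections_sec x)
  have him : ∀ z ∈ numericalRange T, ∀ᵐ ω ∂μ, (z ω).im = 0 := by
    rintro _ ⟨x, -, rfl⟩
    filter_upwards [hinner x, hs] with ω h1 h2
    rw [h1, ← Complex.conj_eq_iff_im, inner_conj_symm]
    exact h2 _ _
  let R : Set (Ω →ₘ[μ] ℝ) := {f | toComplex f ∈ numericalRange T}
  have hR : toComplex '' R = numericalRange T := by
    ext z
    constructor
    · rintro ⟨f, hf, rfl⟩
      exact hf
    · intro hz
      obtain ⟨f, rfl⟩ := exists_toComplex_eq (him z hz)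
      exact ⟨f, hz, rfl⟩
  have hne : R.Nonempty := by
    obtain ⟨u, hu, -⟩ := exists_normalized hS (0 : L22 μ m q)
    have : (toComplex '' R).Nonempty := by
      rw [hR]
      exact ⟨_, u, hu, rfl⟩
    exact this.of_image
  have hbd : ∀ f ∈ R, ∀ᵐ ω ∂μ, |f ω| ≤ N := by
    rintro f ⟨u, hu, hf⟩
    filter_upwards [hinner u, ae_norm_sec_eq_one hu, hN, coeFn_toComplex f] with ω h1 h2 h3 h4
    rw [← Real.norm_eq_abs, ← Complex.norm_real, ← h4, hf, h1]
    refine (norm_inner_le_norm _ _).trans ?_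
    rw [h2, one_mul]
    simpa [h2] using (t ω).le_of_opNorm_le h3 (sec u.1 ω)
  obtain ⟨lo, hlo⟩ := exists_isGLB hne ⟨AEEqFun.const Ω (-N), fun f hf => by
    rw [← AEEqFun.coeFn_le]
    filter_upwards [hbd f hf, AEEqFun.coeFn_const (μ := μ) Ω (-N)] with ω h1 h2
    rw [h2]
    exact (abs_le.1 h1).1⟩
  obtain ⟨hi, hhi⟩ := exists_isLUB hne ⟨AEEqFun.const Ω N, fun f hf => by
    rw [← AEEqFun.coeFn_le]
    filter_upwards [hbd f hf, AEEqFun.coeFn_const (μ := μ) Ω N] with ω h1 h2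
    rw [h2]
    exact (abs_le.1 h1).2⟩
  refine ⟨lo, hi, ?_, ?_⟩
  · rw [← hR]
    exact isGLB_toComplex_image hne hlo
  · rw [← hR]
    exact isLUB_toComplex_image hne hhi

end NumericalRange

/-! ### Properties of glued spectral projections -/

section Glued

variable {T E E' : L22 μ m q →ₗ[ℂ] L22 μ m q} {t : Ω → Lp ℂ 2 m →L[ℂ] Lp ℂ 2 m}
  {l l' : Ω →ₘ[μ] ℝ}

theorem isOrthogonalProjector_of_decomposes
    (hE : Decomposes E fun ω => spectralProjection (t ω) (l ω)) : IsOrthogonalProjector E where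
  l0_linear := hE.isL0Linear
  l0_bounded := hE.isL0Bounded (Eventually.of_forall fun ω => Submodule.starProjection_norm_le _)
  idempotent x := by
    refine (hE.apply (hE x)).l22_ext ((hE x).congr (Eventually.of_forall fun ω => ?_))
    exact (Submodule.starProjection_eq_self_iff.2 (Submodule.starProjection_apply_mem _ _)).symm
  symmetric x y := by
    refine AEEqFun.ext ?_
    filter_upwards [(hE x).inner₀ (hasSections_sec y), (hasSections_sec x).inner₀ (hE y)]
      with ω h1 h2
    rw [h1, h2]
    exact (Submodule.inner_starProjection_left_eq_right _ _ _).symm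

theorem isGluedFrom_of_decomposes {k : Ω → S → S → ℂ} {K : ℝ}
    (hk : ∀ᵐ ω ∂μ, IsFiberKernel m K (k ω))
    (hE : Decomposes E fun ω => spectralProjection (fiberCLM m k K ω) (l ω)) :
    IsGluedFrom k l E := by
  intro x
  filter_upwards [hE x, x.2.1, hk] with ω h1 h2 h3
  refine ⟨h2, ?_⟩
  rw [spectralProjection_fiberCLM h3, ← sec_eq_toLp h2]
  exact h1

theorem opLE_comp_scalarMul
    (ht : ∀ᵐ ω ∂μ, IsCompactOperator (t ω) ∧
    (t ω : Lp ℂ 2 m →ₗ[ℂ] Lp ℂ 2 m).IsSymmetric)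
    (hT : Decomposes T t)
    (hE : Decomposes E fun ω => spectralProjection (t ω) (l ω)) :
    OpLE (fun x => (E (T x) : Ω × S →ₘ[μ.prod m] ℂ))
      (fun x => scalarMul μ m (toComplex l) (E x)) := by
  intro x
  rw [← AEEqFun.coeFn_le]
  filter_upwards [ht, (hE.apply (hT x)).inner₀ (hasSections_sec x),
    ((hE x).scalarMul (toComplex l)).inner₀ (hasSections_sec x), coeFn_toComplex l]
    with ω h1 h2 h3 h4
  rw [h2, h3, h4]
  exact inner_spectralProjection_apply_le h1.1 h1.2 _ _

theorem opLE_scalarMul_sub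
    (ht : ∀ᵐ ω ∂μ, IsCompactOperator (t ω) ∧
    (t ω : Lp ℂ 2 m →ₗ[ℂ] Lp ℂ 2 m).IsSymmetric)
    (hT : Decomposes T t)
    (hE : Decomposes E fun ω => spectralProjection (t ω) (l ω)) :
    OpLE (fun x => scalarMul μ m (toComplex l) ((x - E x : L22 μ m q)))
      (fun x => (T (x - E x) : Ω × S →ₘ[μ.prod m] ℂ)) := by
  intro x
  have hx := hasSections_sec x
  have hd : HasSections ((x - E x : L22 μ m q) : Ω × S →ₘ[μ.prod m] ℂ) _ := hx.sub (hE x)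
  rw [← AEEqFun.coeFn_le]
  filter_upwards [ht, (hT.apply hd).inner₀ hx, (hd.scalarMul (toComplex l)).inner₀ hx,
    coeFn_toComplex l] with ω h1 h2 h3 h4
  rw [h2, h3, h4]
  exact inner_le_apply_sub_spectralProjection h1.1 h1.2 _ _

theorem opLE_of_le
    (ht : ∀ᵐ ω ∂μ, IsCompactOperator (t ω) ∧
    (t ω : Lp ℂ 2 m →ₗ[ℂ] Lp ℂ 2 m).IsSymmetric)
    (h : l ≤ l') (hE : Decomposes E fun ω => spectralProjection (t ω) (l ω))
    (hE' : Decomposes E' fun ω => spectralProjection (t ω) (l' ω)) :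
    OpLE (fun x => (E x : Ω × S →ₘ[μ.prod m] ℂ)) (fun x => E' x) := by
  intro x
  rw [← AEEqFun.coeFn_le]
  filter_upwards [ht, (hE x).inner₀ (hasSections_sec x), (hE' x).inner₀ (hasSections_sec x),
    AEEqFun.coeFn_le.2 h] with ω h1 h2 h3 h4
  rw [h2, h3]
  exact inner_spectralProjection_mono h1.1 h1.2 h4 _

theorem isLUB_strictlyBelow
    (ht : ∀ᵐ ω ∂μ, IsCompactOperator (t ω) ∧
    (t ω : Lp ℂ 2 m →ₗ[ℂ] Lp ℂ 2 m).IsSymmetric)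
    {E : (Ω →ₘ[μ] ℝ) → (L22 μ m q →ₗ[ℂ] L22 μ m q)}
    (hE : ∀ l, Decomposes (E l) fun ω => spectralProjection (t ω) (l ω)) (l' : Ω →ₘ[μ] ℝ)
    (x : L22 μ m q) :
    IsLUB {z | ∃ l, StrictlyBelow l l' ∧ z = inner₀ (E l x : Ω × S →ₘ[μ.prod m] ℂ) x}
      (inner₀ (E l' x : Ω × S →ₘ[μ.prod m] ℂ) x) := by
  have := Complex.orderClosedTopology
  have hx := hasSections_sec x
  refine ⟨?_, fun z hz => ?_⟩
  · rintro _ ⟨l, hl, rfl⟩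
    exact opLE_of_le ht (AEEqFun.coeFn_le.1 (hl.mono fun ω => le_of_lt)) (hE l) (hE l') x
  -- The sequence `l' - 1/(n+1)` lies strictly below `l'`, and left continuity in each fibre shows
  -- that it already determines the supremum.
  · have hc : ∀ n : ℕ, Continuous fun r : ℝ => r - 1 / ((n : ℝ) + 1) := fun n => by fun_prop
    have hcoe := fun n => AEEqFun.coeFn_comp _ (hc n) l'
    have h1 : ∀ n : ℕ, inner₀ (E (AEEqFun.comp _ (hc n) l') x : Ω × S →ₘ[μ.prod m] ℂ) x ≤ z := by
      refine fun n => hz ⟨_, ?_, rfl⟩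
      filter_upwards [hcoe n] with ω hω
      rw [hω, Function.comp_apply, sub_lt_self_iff]
      positivity
    rw [← AEEqFun.coeFn_le]
    filter_upwards [ht, (hE l' x).inner₀ hx, ae_all_iff.2 hcoe,
      ae_all_iff.2 fun n => AEEqFun.coeFn_le.2 (h1 n),
      ae_all_iff.2 fun n => (hE (AEEqFun.comp _ (hc n) l') x).inner₀ hx] with ω h2 h3 h4 h5 h6
    rw [h3]
    refine le_of_tendsto ((continuous_const.inner continuous_id).tendsto _ |>.comp
      (tendsto_spectralProjection h2.1 h2.2 (l' ω) (sec x.1 ω)))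
      (Eventually.of_forall fun n => ?_)
    have := h5 n
    rwa [h6, h4] at this

/-- Let `u` normalize `E x`. In a fibre where `E x ≠ 0`, `u` lies in the range of the projection, so
`⟨T u, u⟩ ≤ l < lo ≤ ⟨T u, u⟩`, a contradiction. -/
theorem eq_zero_of_strictlyBelow
    (ht : ∀ᵐ ω ∂μ, IsCompactOperator (t ω) ∧
    (t ω : Lp ℂ 2 m →ₗ[ℂ] Lp ℂ 2 m).IsSymmetric)
    (hS : m ≠ 0) (hT : Decomposes T t) {lo : Ω →ₘ[μ] ℝ}
    (hlo : toComplex lo ∈ lowerBounds (numericalRange T)) (h : StrictlyBelow l lo)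
    (hE : Decomposes E fun ω => spectralProjection (t ω) (l ω)) : E = 0 := by
  refine LinearMap.ext fun x => ?_
  obtain ⟨u, hu, hu'⟩ := exists_normalized hS (E x)
  have h1 := AEEqFun.coeFn_le.2 (hlo ⟨u, hu, rfl⟩)
  refine ((hasSections_sec (E x)).congr ?_).l22_ext HasSections.zero
  filter_upwards [ht, hu', h1, (hT u).inner₀ (hasSections_sec u), h, coeFn_toComplex lo,
    (hE x).sec_eq] with ω h2 h3 h4 h5 h6 h7 h8
  by_contra h0
  have hPu : spectralProjection (t ω) (l ω) (sec u.1 ω) = sec u.1 ω := by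
    rw [h3.2 h0, map_smul, h8]
    congr 1
    exact Submodule.starProjection_eq_self_iff.2 (Submodule.starProjection_apply_mem _ _)
  have h9 := inner_spectralProjection_apply_le h2.1 h2.2 (l ω) (sec u.1 ω)
  have h10 : ⟪sec u.1 ω, spectralProjection (t ω) (l ω) (t ω (sec u.1 ω))⟫_ℂ
      = ⟪spectralProjection (t ω) (l ω) (sec u.1 ω), t ω (sec u.1 ω)⟫_ℂ :=
    (Submodule.inner_starProjection_left_eq_right _ _ _).symm
  rw [h10, hPu, inner_smul_right, inner_self_eq_norm_sq_to_K, h3.1] at h9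
  rw [h7, h5] at h4
  have h11 := h4.trans h9
  simp only [Complex.coe_algebraMap, Complex.ofReal_one, one_pow, mul_one,
    Complex.real_le_real] at h11
  exact absurd h6 (not_lt.2 h11)

/-- The dual argument with `x - E x`: where it is nonzero, its normalization is killed by the
projection, so `⟨T u, u⟩ ≥ l > hi`. -/
theorem eq_id_of_strictlyBelow
    (ht : ∀ᵐ ω ∂μ, IsCompactOperator (t ω) ∧
    (t ω : Lp ℂ 2 m →ₗ[ℂ] Lp ℂ 2 m).IsSymmetric)
    (hS : m ≠ 0) (hT : Decomposes T t) {hi : Ω →ₘ[μ] ℝ}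
    (hhi : toComplex hi ∈ upperBounds (numericalRange T)) (h : StrictlyBelow hi l)
    (hE : Decomposes E fun ω => spectralProjection (t ω) (l ω)) : E = LinearMap.id := by
  refine LinearMap.ext fun x => ?_
  obtain ⟨u, hu, hu'⟩ := exists_normalized hS (x - E x)
  have h1 := AEEqFun.coeFn_le.2 (hhi ⟨u, hu, rfl⟩)
  have hd : HasSections ((x - E x : L22 μ m q) : Ω × S →ₘ[μ.prod m] ℂ) _ :=
    (hasSections_sec x).sub (hE x)
  refine (hE x).l22_ext ((hasSections_sec x).congr ?_)
  filter_upwards [ht, hu', h1, (hT u).inner₀ (hasSections_sec u), h, coeFn_toComplex hi,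
    hd.sec_eq] with ω h2 h3 h4 h5 h6 h7 h8
  by_contra h0
  have hPu : spectralProjection (t ω) (l ω) (sec u.1 ω) = 0 := by
    rw [h3.2 (by rw [h8]; exact sub_ne_zero.2 h0), map_smul, h8, map_sub]
    rw [show spectralProjection (t ω) (l ω) (spectralProjection (t ω) (l ω) (sec x.1 ω))
      = spectralProjection (t ω) (l ω) (sec x.1 ω) from
      Submodule.starProjection_eq_self_iff.2 (Submodule.starProjection_apply_mem _ _),
      sub_self, smul_zero]
  have h9 := inner_le_apply_sub_spectralProjection h2.1 h2.2 (l ω) (sec u.1 ω)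
  rw [hPu, sub_zero, inner_smul_right, inner_self_eq_norm_sq_to_K, h3.1] at h9
  rw [h7, h5] at h4
  have h11 := h9.trans h4
  simp only [Complex.coe_algebraMap, Complex.ofReal_one, one_pow, mul_one,
    Complex.real_le_real] at h11
  exact absurd h6 (not_lt.2 h11)

end Glued

end

end PartialIntegral

/-! ### Assembly of the spectral family. -/

theorem mainTheorem2 {Ω S : Type*} [MeasurableSpace Ω] [MeasurableSpace S]
    (μ : Measure Ω) (m : Measure S) [IsFiniteMeasure μ] [IsFiniteMeasure m]
    (hS : m ≠ 0) (q : ℝ≥0∞) (k : Ω → S → S → ℂ)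
    (hk : IsBoundedKernel μ m k)
    (hherm : IsHermitianKernel μ m k)
    (hpos : IsPosSemidefKernel μ m q k) :
    ∃ lo hi : Ω →ₘ[μ] ℝ,
      IsGLB (numericalRange (partialIntegralOperator hk q)) (toComplex lo) ∧
      IsLUB (numericalRange (partialIntegralOperator hk q)) (toComplex hi) ∧
      ∃ E : (Ω →ₘ[μ] ℝ) → (L22 μ m q →ₗ[ℂ] L22 μ m q),
        (∀ l, IsOrthogonalProjector (E l)) ∧
        (∀ l, IsGluedFrom k l (E l)) ∧
        (∀ l, ∀ C : L22 μ m q →ₗ[ℂ] L22 μ m q, IsL0Linear C → IsL0Bounded C →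
          C ∘ₗ partialIntegralOperator hk q = partialIntegralOperator hk q ∘ₗ C →
          E l ∘ₗ C = C ∘ₗ E l) ∧
        (∀ l, OpLE (fun x => (E l (partialIntegralOperator hk q x) : Ω × S →ₘ[μ.prod m] ℂ))
          (fun x => scalarMul μ m (toComplex l) (E l x))) ∧
        (∀ l, OpLE (fun x => scalarMul μ m (toComplex l) ((x - E l x : L22 μ m q)))
          (fun x => (partialIntegralOperator hk q (x - E l x) : Ω × S →ₘ[μ.prod m] ℂ))) ∧
        (∀ l l', l ≤ l' → OpLE (fun x => (E l x : Ω × S →ₘ[μ.prod m] ℂ)) (fun x => E l' x)) ∧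
        (∀ l', ∀ x : L22 μ m q,
          IsLUB {z | ∃ l, StrictlyBelow l l' ∧ z = inner₀ (E l x : Ω × S →ₘ[μ.prod m] ℂ) x}
            (inner₀ (E l' x : Ω × S →ₘ[μ.prod m] ℂ) x)) ∧
        (∀ l, StrictlyBelow l lo → E l = 0) ∧
        (∀ l, StrictlyBelow hi l → E l = LinearMap.id) := by
  obtain ⟨K, hK0, hK⟩ := exists_isFiberKernel hk hherm
  have hT := decomposes_partialIntegralOperator (q := q) hk hK
  have ht : ∀ᵐ ω ∂μ, IsCompactOperator (fiberCLM m k K ω) ∧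
      (fiberCLM m k K ω : Lp ℂ 2 m →ₗ[ℂ] Lp ℂ 2 m).IsSymmetric :=
    hK.mono fun ω h => ⟨isCompactOperator_fiberCLM h, isSymmetric_fiberCLM h⟩
  have hN : ∀ᵐ ω ∂μ, ‖fiberCLM m k K ω‖ ≤ K * m.real Set.univ :=
    Eventually.of_forall fun ω => norm_fiberCLM_le hK0
  obtain ⟨lo, hi, hlo, hhi⟩ :=
    exists_bounds_numericalRange hS hT (ht.mono fun ω h => h.2) hN
  choose E hE hcomm using exists_glued_spectralProjection hT
    ((ht.and hN).mono fun ω h => ⟨h.1.1, h.1.2, h.2⟩) (mul_nonneg hK0 measureReal_nonneg)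
  exact ⟨lo, hi, hlo, hhi, E, fun l => isOrthogonalProjector_of_decomposes (hE l),
    fun l => isGluedFrom_of_decomposes hK (hE l), hcomm,
    fun l => opLE_comp_scalarMul ht hT (hE l), fun l => opLE_scalarMul_sub ht hT (hE l),
    fun l l' h => opLE_of_le ht h (hE l) (hE l'), fun l' x => isLUB_strictlyBelow ht hE l' x,
    fun l h => eq_zero_of_strictlyBelow ht hS hT hlo.1 h (hE l),
    fun l h => eq_id_of_strictlyBelow ht hS hT hhi.1 h (hE l)⟩
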